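/- Let $G$ be a finite abelian group. For a set $\Gamma$ of characters of $G$ (homomorphisms $G\to\mathbb{C}^\times$) and $\rho\ge 0$, the Bohr set $B=\mathrm{Bohr}(\Gamma,\rho)$ is the set $\{x\in G: |\gamma(x)-1|\le\rho \text{ for all } \gamma\in\Gamma\}$, considered together with the data of its rank $|\Gamma|$ and its radius $\rho$; we write $B_\delta=\mathrm{Bohr}(\Gamma,\delta\rho)$. We write $\mathrm{Bohr}(\Gamma',\rho')\le \mathrm{Bohr}(\Gamma,\rho)$ if $\Gamma'\supset\Gamma$ and $\rho'\le\rho$. A Bohr set $B$ of rank $d$ is regular if $1-12d|\delta|\le |B_{1+\delta}|/|B|\le 1+12d|\delta|$ whenever $12d|\delta|\le 1$. Convolution is $f*g(x)=\sum_{y\in G}f(y)g(x-y)$, $1_X$ is the indicator function of $X$, $\mu_X=1_X/|X|$, and $\|\cdot\|_\infty$ is the maximum norm on functions $G\to\mathbb{C}$. There is an absolute constant $C>0$ such that the following holds. Let $\epsilon\in(0,1)$, let $A,M,L$ be non-empty subsets of a finite abelian group $G$, and let $B\subset G$ be a regular Bohr set of rank $d$ and radius $\rho\in[0,2]$. Suppose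 that $|A+S|\le K|A|$ for a subset $S\subset B$ with $|S|/|B|\ge\sigma>0$, and assume that $\eta:=|M|/|L|\le 1$. Then there are a positive integer \[ d'\le C\left(\epsilon^{-2}\log^2(2/\epsilon\eta)\,\log(2/\eta)\,\log(2K)+\log(1/\sigma)\right) \] and a regular Bohr set $B'\le B$ of rank at most $d+d'$ and radius at least $\rho\,\epsilon\,\eta^{1/2}/(\max(d,1)^2 d')$ such that \[ \|1_A*1_M*1_L(\cdot+t)-1_A*1_M*1_L\|_\infty\le\epsilon|A||M| \quad\text{for all } t\in B'. \] In particular, \[ \|1_A*1_M*1_L*\mu_{B'}-1_A*1_M*1_L\|_\infty\le\epsilon|A||M|. \] -/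

import Mathlib

open scoped Pointwise

noncomputable section

/-- The data of a Bohr set in an abelian group `G`: a finite set of characters and a radius.
The rank and the radius belong to the data, not to the underlying set of points. -/
structure BohrSet (G : Type*) [AddCommGroup G] where
  /-- the frequency set, consisting of homomorphisms from `G` to the unit group of `ℂ` -/
  chars : Finset (AddChar G ℂ)
  /-- the radius -/
  radius : ℝ
  radius_nonneg : 0 ≤ radius

namespace BohrSet

variable {G : Type*} [AddCommGroup G]

/-- The rank is the number of characters. -/
def rank (B : BohrSet G) : ℕ := B.chars.card

/-- The sub-Bohr set relation `B' ≤ B`: more characters and a smaller radius. -/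
instance : LE (BohrSet G) where
  le B' B := B.chars ⊆ B'.chars ∧ B'.radius ≤ B.radius

variable [Fintype G]

open Classical in
/-- The points of the dilate `B_δ`, that is, of the Bohr set on the same characters
with radius `δ * B.radius`. -/
def dilate (B : BohrSet G) (δ : ℝ) : Finset G :=
  {x : G | ∀ γ ∈ B.chars, ‖γ x - 1‖ ≤ δ * B.radius}

open Classical in
/-- The points of the Bohr set `B`. -/
def points (B : BohrSet G) : Finset G :=
  {x : G | ∀ γ ∈ B.chars, ‖γ x - 1‖ ≤ B.radius}

/-- `B` of rank `d` is regular if `1 - 12 d |δ| ≤ |B_{1+δ}| / |B| ≤ 1 + 12 d |δ|` whenever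
`|δ| ≤ 1 / (12 d)`; the last condition is written without division, so that it also reads
correctly for `d = 0`. -/
def IsRegular (B : BohrSet G) : Prop :=
  ∀ δ : ℝ, 12 * (B.rank : ℝ) * |δ| ≤ 1 →
    1 - 12 * (B.rank : ℝ) * |δ| ≤ ((B.dilate (1 + δ)).card : ℝ) / (B.points.card : ℝ) ∧
      ((B.dilate (1 + δ)).card : ℝ) / (B.points.card : ℝ) ≤ 1 + 12 * (B.rank : ℝ) * |δ|

end BohrSet

/-- The indicator function `1_X`. -/
def setInd {G : Type*} (X : Finset G) : G → ℂ := Set.indicator (X : Set G) 1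

/-- The normalised indicator function `μ_X = 1_X / |X|`. -/
def setMu {G : Type*} (X : Finset G) : G → ℂ := fun x => setInd X x / (X.card : ℂ)

/-- The (unnormalised) convolution `f * g (x) = ∑ y, f y * g (x - y)`. -/
def conv {G : Type*} [AddCommGroup G] [Fintype G] (f g : G → ℂ) : G → ℂ :=
  fun x => ∑ y : G, f y * g (x - y)

/-- The threefold convolution `1_A * 1_M * 1_L`. -/
def tripleConv {G : Type*} [AddCommGroup G] [Fintype G] (A M L : Finset G) : G → ℂ :=
  conv (conv (setInd A) (setInd M)) (setInd L)

end

/-! Write `f` for `1_A * 1_M * 1_L`. The proof finds almost periods of `f` by random sampling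
(Croot–Sisask) and then replaces them by a Bohr set through Fourier analysis (Chang).

Sampling: for a random `n`-tuple `p` in `A`, `∑ i, 1_L(x - p i)` is close to `n * (1_A * 1_L)(x) /
|A|` in `L^{2m}` (`sum_sampling_error_le`). The moment bound is linear in the variance, so summing
it over `x` produces a factor `|L|` rather than `|G|`. Convolving with `1_M` makes the approximation
uniform; the loss of a power `1/(2m)` of `|L|/|M|` is bounded once `m` is about `log (2/η)`.
Translates of good tuples by elements of `S` lie in `(A + S)^n`, which has at most `K^n |A|^n`
elements. By pigeonhole there is `T ⊆ S` of size at least `|S| / (2 K^n)`, all of whose differences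
are almost periods (`exists_almost_periods`).

Bootstrapping: convolving `f` with `μ_T * μ_{-T}` `k` times costs `k` times the sampling error, and
damps the coefficients outside the `1/2`-spectrum of `T` by `4^{-k}`. The coefficients of `f` have
total mass at most `|A| √(|M||L|) = |A||M| η^{-1/2}`. Hence with `k` about `log (2/εη)` every `t` on
which the large spectrum is within `ε √η / 4` of `1` is an almost period (`norm_translate_sub_le`).

Chang's theorem relative to `B` (`exists_control_of_large_spectrum`) controls that spectrum by
`O(log (K^n/σ))` characters and the large spectrum of a smaller regular Bohr set, whose characters
are nearly constant on a still smaller one. Since `n` is about `ε^{-2} k^2 m`, this is the bound for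
`d'`. Regular radii exist by a Vitali covering argument on the logarithmic scale
(`exists_isRegular`). -/

/-! ### Covering intervals of fast growth. -/

open Finset in
/-- The increments of a monotone function along disjoint intervals add up to at most its total
increment. -/
theorem sum_increments_le_of_pairwiseDisjoint {ι : Type*} {f : ℝ → ℝ} (hf : Monotone f)
    (l r : ι → ℝ) (a : ℝ) (s : Finset ι) (hlr : ∀ i ∈ s, l i ≤ r i) (ha : ∀ i ∈ s, a ≤ l i)
    (hd : (s : Set ι).PairwiseDisjoint fun i => Set.Icc (l i) (r i)) :
    ∀ b, a ≤ b → (∀ i ∈ s, r i ≤ b) → ∑ i ∈ s, (f (r i) - f (l i)) ≤ f b - f a := by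
  classical
  -- By disjointness the interval with the largest right endpoint lies to the right of all others,
  -- so its left endpoint can serve as `b` for them.
  induction s using Finset.induction_on_max_value r with
  | empty => intro b hb _; simpa using hf hb
  | insert i s hi hmax ih =>
    intro b hb hrb
    rw [Finset.sum_insert hi]
    have key := ih (fun j hj => hlr j (mem_insert_of_mem hj)) (fun j hj => ha j (mem_insert_of_mem hj))
      (hd.subset (by simp)) (l i) (ha i (mem_insert_self _ _)) ?_
    · have := hf (hrb i (mem_insert_self _ _))
      linarith
    · intro j hj
      by_contra! hlt
      have hne : i ≠ j := fun h => hi (h ▸ hj)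
      have := hd (by simp) (by simp [hj]) hne
      exact Set.disjoint_left.1 this (show r j ∈ _ from ⟨hlt.le, hmax j hj⟩)
        ⟨hlr j (mem_insert_of_mem hj), le_rfl⟩

/-- A covering bound: if every point of `[p, q]` lies in an interval on which the monotone
function `f` has slope at least `c`, then the total increment of `f` is at least a fixed
proportion of `c * (q - p)`. -/
theorem slope_mul_length_le_increment {f : ℝ → ℝ} (hf : Monotone f) {a b p q c : ℝ} (hc : 0 < c)
    (hab : a ≤ b)
    (h : ∀ s ∈ Set.Icc p q, ∃ l r, l < r ∧ l ≤ s ∧ s ≤ r ∧ a ≤ l ∧ r ≤ b ∧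
      c * (r - l) ≤ f r - f l) :
    c * (q - p) ≤ 16 / 5 * (f b - f a) := by
  choose! l r hlr hls hsr hal hrb hinc using h
  -- Vitali's lemma needs an enlargement factor above 3; `16 / 5` is small enough for the numerical
  -- contradiction in `exists_isRegular`.
  obtain ⟨u, hut, hdisj, hcov⟩ := Vitali.exists_disjoint_subfamily_covering_enlargement_closedBall
    (Set.Icc p q) (fun s => (l s + r s) / 2) (fun s => (r s - l s) / 2) (b - a)
    (fun s hs => by
      have := hal s hs
      have := hrb s hs
      have := hlr s hs
      linarith) (16 / 5) (by norm_num)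
  have hball : ∀ s, Metric.closedBall ((l s + r s) / 2) ((r s - l s) / 2) = Set.Icc (l s) (r s) := by
    intro s
    rw [Real.closedBall_eq_Icc]
    congr 1 <;> ring
  simp only [hball] at hdisj hcov
  have hcount : u.Countable := hdisj.countable_of_nonempty_interior fun i hi => by
    rw [interior_Icc]
    exact Set.nonempty_Ioo.2 (hlr i (hut hi))
  have hfin : ∀ F : Finset u, ∑ i ∈ F, (r i - l i) ≤ (f b - f a) / c := by
    intro F
    have := sum_increments_le_of_pairwiseDisjoint hf (fun i : u => l i) (fun i : u => r i) a F
      (fun (i : u) _ => (hlr i (hut i.2)).le) (fun (i : u) _ => hal i (hut i.2)) (by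
        intro i _ j _ hij
        exact hdisj i.2 j.2 (fun h => hij (Subtype.ext h))) b hab (fun (i : u) _ => hrb i (hut i.2))
    rw [le_div_iff₀ hc, mul_comm, Finset.mul_sum]
    exact (Finset.sum_le_sum fun (i : u) _ => hinc i (hut i.2)).trans this
  have hsub : Set.Icc p q ⊆ ⋃ i ∈ u,
      Metric.closedBall ((l i + r i) / 2) (16 / 5 * ((r i - l i) / 2)) := by
    intro s hs
    obtain ⟨i, hi, hsi⟩ := hcov s hs
    exact Set.mem_biUnion hi (hsi ⟨hls s hs, hsr s hs⟩)
  have hvol := (MeasureTheory.measure_mono hsub).trans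
    (MeasureTheory.measure_biUnion_le MeasureTheory.volume hcount _)
  have hnn : 0 ≤ 16 / 5 * ((f b - f a) / c) := by
    have := hf hab
    have : 0 ≤ f b - f a := by linarith
    positivity
  have htsum : (∑' i : u, MeasureTheory.volume
      (Metric.closedBall ((l i + r i) / 2) (16 / 5 * ((r i - l i) / 2)))) ≤
      ENNReal.ofReal (16 / 5 * ((f b - f a) / c)) := by
    rw [ENNReal.tsum_eq_iSup_sum]
    refine iSup_le fun F => ?_
    simp only [Real.volume_closedBall]
    rw [← ENNReal.ofReal_sum_of_nonneg (fun i _ => by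
      have := hlr i (hut i.2)
      linarith)]
    refine ENNReal.ofReal_le_ofReal ?_
    have := hfin F
    calc ∑ i ∈ F, 2 * (16 / 5 * ((r i - l i) / 2)) = 16 / 5 * ∑ i ∈ F, (r i - l i) := by
          rw [Finset.mul_sum]; exact Finset.sum_congr rfl fun i _ => by ring
      _ ≤ _ := by linarith
  have := hvol.trans htsum
  rw [Real.volume_Icc, ENNReal.ofReal_le_ofReal_iff hnn] at this
  calc c * (q - p) ≤ c * (16 / 5 * ((f b - f a) / c)) := by gcongr
    _ = _ := by field_simp

/-! ### Bohr sets: doubling and the existence of regular radii. -/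

open Classical in
/-- The points of the Bohr set with frequency set `Γ` and (arbitrary real) radius `r`. -/
noncomputable def bohrPts {G : Type*} [AddCommGroup G] [Fintype G] (Γ : Finset (AddChar G ℂ)) (r : ℝ) :
    Finset G :=
  {x : G | ∀ γ ∈ Γ, ‖γ x - 1‖ ≤ r}

section Bohr

variable {G : Type*} [AddCommGroup G] [Fintype G] {Γ : Finset (AddChar G ℂ)} {r s : ℝ}

theorem mem_bohrPts {x : G} : x ∈ bohrPts Γ r ↔ ∀ γ ∈ Γ, ‖γ x - 1‖ ≤ r := by
  simp [bohrPts]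

theorem BohrSet.points_eq (B : BohrSet G) : B.points = bohrPts B.chars B.radius := rfl

theorem BohrSet.dilate_eq (B : BohrSet G) (δ : ℝ) :
    B.dilate δ = bohrPts B.chars (δ * B.radius) := rfl

theorem bohrPts_mono (h : r ≤ s) : bohrPts Γ r ⊆ bohrPts Γ s := fun x hx => by
  rw [mem_bohrPts] at *
  exact fun γ hγ => (hx γ hγ).trans h

theorem zero_mem_bohrPts (h : 0 ≤ r) : (0 : G) ∈ bohrPts Γ r := by
  simpa [mem_bohrPts] using fun _ _ => h

theorem card_bohrPts_pos (h : 0 ≤ r) : 0 < (bohrPts Γ r : Finset G).card :=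
  Finset.card_pos.2 ⟨0, zero_mem_bohrPts h⟩

theorem AddChar.norm_map_sub_sub_one (γ : AddChar G ℂ) (x y : G) :
    ‖γ (x - y) - 1‖ = ‖γ x - γ y‖ := by
  rw [AddChar.map_sub_eq_div, div_sub_one (norm_ne_zero_iff.1 (by simp [AddChar.norm_apply])),
    norm_div, AddChar.norm_apply, div_one]

theorem AddChar.norm_map_neg_sub_one (γ : AddChar G ℂ) (x : G) : ‖γ (-x) - 1‖ = ‖γ x - 1‖ := by
  have := AddChar.norm_map_sub_sub_one γ 0 x
  rw [zero_sub, AddChar.map_zero_eq_one] at this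
  rw [this, norm_sub_rev]

theorem AddChar.norm_map_add_sub_one_le (γ : AddChar G ℂ) (x y : G) :
    ‖γ (x + y) - 1‖ ≤ ‖γ x - 1‖ + ‖γ y - 1‖ := by
  have h : γ (x + y) - 1 = γ y * (γ x - 1) + (γ y - 1) := by
    rw [AddChar.map_add_eq_mul]; ring
  rw [h]
  refine (norm_add_le _ _).trans ?_
  rw [norm_mul, AddChar.norm_apply, one_mul]

theorem neg_mem_bohrPts {x : G} (hx : x ∈ bohrPts Γ r) : -x ∈ bohrPts Γ r := by
  rw [mem_bohrPts] at *
  intro γ hγ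
  rw [AddChar.norm_map_neg_sub_one]
  exact hx γ hγ

theorem add_mem_bohrPts {x y : G} (hx : x ∈ bohrPts Γ r) (hy : y ∈ bohrPts Γ s) :
    x + y ∈ bohrPts Γ (r + s) := by
  rw [mem_bohrPts] at *
  exact fun γ hγ => (AddChar.norm_map_add_sub_one_le γ x y).trans (add_le_add (hx γ hγ) (hy γ hγ))

/-- On a short arc of the unit circle around `1`, distances are governed by imaginary parts. -/
theorem norm_sub_le_of_abs_im_sub_le {z w : ℂ} {R t : ℝ} (hz : ‖z‖ = 1) (hw : ‖w‖ = 1)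
    (hR : R ≤ 1 / 5) (hz1 : ‖z - 1‖ ≤ R) (hw1 : ‖w - 1‖ ≤ R) (h : |z.im - w.im| ≤ t) :
    ‖z - w‖ ≤ 103 / 100 * t := by
  have ht : 0 ≤ t := (abs_nonneg _).trans h
  have hzi : |z.im| ≤ 1 / 5 := by
    have := Complex.abs_im_le_norm (z - 1)
    simp at this; linarith
  have hwi : |w.im| ≤ 1 / 5 := by
    have := Complex.abs_im_le_norm (w - 1)
    simp at this; linarith
  have hzr : 4 / 5 ≤ z.re := by
    have := Complex.abs_re_le_norm (z - 1)
    simp only [Complex.sub_re, Complex.one_re] at this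
    linarith [(abs_le.1 (this.trans (hz1.trans hR))).1]
  have hwr : 4 / 5 ≤ w.re := by
    have := Complex.abs_re_le_norm (w - 1)
    simp only [Complex.sub_re, Complex.one_re] at this
    linarith [(abs_le.1 (this.trans (hw1.trans hR))).1]
  have ez : z.re ^ 2 + z.im ^ 2 = 1 := by
    have := Complex.sq_norm z; rw [hz, Complex.normSq_apply] at this; linarith
  have ew : w.re ^ 2 + w.im ^ 2 = 1 := by
    have := Complex.sq_norm w; rw [hw, Complex.normSq_apply] at this; linarith
  have hzr' : 24 / 25 ≤ z.re ^ 2 := by nlinarith [sq_abs z.im, abs_nonneg z.im]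
  have hwr' : 24 / 25 ≤ w.re ^ 2 := by nlinarith [sq_abs w.im, abs_nonneg w.im]
  have hzr2 : 24 / 25 ≤ z.re := by nlinarith
  have hwr2 : 24 / 25 ≤ w.re := by nlinarith
  -- Difference of the two circle equations. The real parts sum to nearly 2 and the imaginary parts
  -- to at most 2/5, so the real parts differ by at most `5/24 * t`.
  have hre : (z.re - w.re) * (z.re + w.re) = - ((z.im - w.im) * (z.im + w.im)) := by linarith
  have hsum : |z.im + w.im| ≤ 2 / 5 := (abs_add_le _ _).trans (by linarith)
  have habs : |z.re - w.re| * (48 / 25) ≤ t * (2 / 5) := by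
    calc |z.re - w.re| * (48 / 25) ≤ |z.re - w.re| * (z.re + w.re) := by
          gcongr; linarith
      _ = |(z.re - w.re) * (z.re + w.re)| := by
          rw [abs_mul, abs_of_pos (by linarith : 0 < z.re + w.re)]
      _ = |z.im - w.im| * |z.im + w.im| := by rw [hre, abs_neg, abs_mul]
      _ ≤ t * (2 / 5) := by gcongr
  have h1 : |z.re - w.re| ≤ 5 / 24 * t := by linarith
  refine le_of_sq_le_sq ?_ (by positivity)
  have h2 : (z.re - w.re) ^ 2 ≤ (5 / 24 * t) ^ 2 := by
    rw [← sq_abs]; gcongr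
  have h3 : (z.im - w.im) ^ 2 ≤ t ^ 2 := by
    rw [← sq_abs]; gcongr
  rw [Complex.sq_norm, Complex.normSq_apply]
  simp only [Complex.sub_re, Complex.sub_im]
  nlinarith

open Classical in
/-- Doubling of small Bohr sets. -/
theorem card_bohrPts_le_five_pow_mul {R : ℝ} (hR0 : 0 < R) (hR : R ≤ 1 / 5) :
    (bohrPts Γ R : Finset G).card ≤ 5 ^ Γ.card * (bohrPts Γ (11 / 26 * R) : Finset G).card := by
  have hq : 0 < 41 / 100 * R := by positivity
  -- Imaginary parts in `[-R, R]` are sorted into cells of length `41/100 * R`: five cells suffice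
  -- as `2 / 0.41 < 5`, and `103/100 * 41/100 ≤ 11/26`.
  let φ : G → (Γ → ℕ) := fun x γ => ⌊((γ.1 x).im + R) / (41 / 100 * R)⌋₊
  have him : ∀ x ∈ bohrPts Γ R, ∀ γ ∈ Γ, |(γ x).im| ≤ R := by
    intro x hx γ hγ
    have := Complex.abs_im_le_norm (γ x - 1)
    simp at this
    exact this.trans (mem_bohrPts.1 hx γ hγ)
  have himg : (bohrPts Γ R).image φ ⊆ Fintype.piFinset fun _ => Finset.range 5 := by
    intro y hy
    obtain ⟨x, hx, rfl⟩ := Finset.mem_image.1 hy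
    rw [Fintype.mem_piFinset]
    intro γ
    rw [Finset.mem_range]
    have h1 := abs_le.1 (him x hx γ.1 γ.2)
    rw [Nat.floor_lt (div_nonneg (by linarith) hq.le), div_lt_iff₀ hq]
    push_cast
    linarith
  have hfib : ∀ y ∈ (bohrPts Γ R).image φ,
      ((bohrPts Γ R).filter fun x => φ x = y).card ≤ (bohrPts Γ (11 / 26 * R) : Finset G).card := by
    intro y hy
    obtain ⟨x, hx, rfl⟩ := Finset.mem_image.1 hy
    refine Finset.card_le_card_of_injOn (fun z => z - x) ?_ (fun _ _ _ _ h => by simpa using h)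
    intro z hz
    obtain ⟨hz, hzx⟩ := Finset.mem_filter.1 hz
    rw [Finset.mem_coe, mem_bohrPts]
    intro γ hγ
    rw [AddChar.norm_map_sub_sub_one]
    have hfl : ⌊((γ z).im + R) / (41 / 100 * R)⌋₊ = ⌊((γ x).im + R) / (41 / 100 * R)⌋₊ :=
      congrFun hzx ⟨γ, hγ⟩
    have bx := abs_le.1 (him x hx γ hγ)
    have bz := abs_le.1 (him z hz γ hγ)
    have ex := Nat.floor_le (div_nonneg (by linarith : 0 ≤ (γ x).im + R) hq.le)
    have ez := Nat.floor_le (div_nonneg (by linarith : 0 ≤ (γ z).im + R) hq.le)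
    have lx := Nat.lt_floor_add_one (((γ x).im + R) / (41 / 100 * R))
    have lz := Nat.lt_floor_add_one (((γ z).im + R) / (41 / 100 * R))
    rw [hfl] at ez lz
    rw [le_div_iff₀ hq] at ex ez
    rw [div_lt_iff₀ hq] at lx lz
    have := norm_sub_le_of_abs_im_sub_le (t := 41 / 100 * R) (AddChar.norm_apply γ z)
      (AddChar.norm_apply γ x) hR (mem_bohrPts.1 hz γ hγ) (mem_bohrPts.1 hx γ hγ)
      (abs_le.2 ⟨by linarith, by linarith⟩)
    refine this.trans ?_
    linarith
  have h1 := Finset.card_le_mul_card_image _ _ hfib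
  have h2 := Finset.card_le_card himg
  rw [Fintype.card_piFinset] at h2
  simp at h2
  calc _ ≤ _ := h1
    _ ≤ _ := by rw [mul_comm]; gcongr

/-- A violation of regularity produces an interval of radii on which the size of the Bohr set
grows fast. -/
theorem exists_growth_interval_of_not_isRegular (B : BohrSet G) (hd : 0 < B.rank)
    (hr : 0 < B.radius) (hB : ¬ B.IsRegular) :
    ∃ l r, l < r ∧ l ≤ Real.log B.radius ∧ Real.log B.radius ≤ r ∧
      Real.log B.radius + Real.log (11 / 12) ≤ l ∧ r ≤ Real.log B.radius + Real.log (13 / 12) ∧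
      8 * (B.rank : ℝ) * (r - l) ≤ Real.log (bohrPts B.chars (Real.exp r)).card
        - Real.log (bohrPts B.chars (Real.exp l)).card := by
  have hd1 : (1 : ℝ) ≤ B.rank := by exact_mod_cast hd
  set d : ℝ := (B.rank : ℝ) with hdd
  set N : ℝ := (B.points.card : ℝ) with hN
  have hNpos : 0 < N := by
    rw [hN]; exact_mod_cast card_bohrPts_pos B.radius_nonneg
  have hpts : ∀ c : ℝ, 0 < c → B.dilate c = bohrPts B.chars (Real.exp (Real.log B.radius + Real.log c)) := by
    intro c hc
    rw [Real.exp_add, Real.exp_log hr, Real.exp_log hc, B.dilate_eq, mul_comm]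
  have hpts1 : bohrPts B.chars (Real.exp (Real.log B.radius)) = B.points := by
    rw [Real.exp_log hr, B.points_eq]
  unfold BohrSet.IsRegular at hB
  push Not at hB
  obtain ⟨δ, hδ, hviol⟩ := hB
  simp only [← hdd, ← hN] at hδ hviol ⊢
  -- The size is monotone in the radius, so for each sign of `δ` only one of the two inequalities
  -- can fail.
  rcases le_total 0 δ with h0 | h0
  · rw [abs_of_nonneg h0] at hδ hviol
    have hmono : N ≤ (B.dilate (1 + δ)).card := by
      rw [hN]
      refine Nat.cast_le.2 (Finset.card_le_card (bohrPts_mono ?_))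
      nlinarith
    have hlow : 1 - 12 * d * δ ≤ (B.dilate (1 + δ)).card / N := by
      rw [le_div_iff₀ hNpos]
      have : 0 ≤ 12 * d * δ * N := by positivity
      nlinarith
    have hup := hviol hlow
    have hδpos : 0 < δ := by
      rcases h0.eq_or_lt with h | h
      · rw [← h] at hup
        have : B.dilate (1 + 0) = B.points := by
          rw [B.dilate_eq, B.points_eq]; simp
        rw [this, ← hN, div_self hNpos.ne'] at hup
        simp at hup
      · exact h
    have hlogpos := Real.log_pos (by linarith : 1 < 1 + δ)
    refine ⟨Real.log B.radius, Real.log B.radius + Real.log (1 + δ), by linarith, le_rfl, by linarith,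
      ?_, ?_, ?_⟩
    · have := Real.log_neg (by norm_num : (0:ℝ) < 11 / 12) (by norm_num)
      linarith
    · have := Real.log_le_log (by linarith) (by nlinarith : 1 + δ ≤ 13 / 12)
      linarith
    · rw [hpts1, ← hpts _ (by linarith), ← hN, ← Real.log_div (by linarith) hNpos.ne']
      have e1 : Real.log (1 + 12 * d * δ) ≤ Real.log ((B.dilate (1 + δ)).card / N) :=
        Real.log_le_log (by positivity) hup.le
      have e2 := Real.le_log_one_add_of_nonneg (x := 12 * d * δ) (by positivity)
      -- With `x = 12 * d * δ ≤ 1`, the bound `2x/(x+2) ≥ 2x/3` is the source of the slope `8 * d`.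
      have e3 : 8 * d * δ ≤ 2 * (12 * d * δ) / (12 * d * δ + 2) := by
        rw [le_div_iff₀ (by positivity)]
        have : 0 ≤ d * δ := by positivity
        nlinarith
      have e4 : Real.log (1 + δ) ≤ δ := by
        have := Real.log_le_sub_one_of_pos (by linarith : 0 < 1 + δ); linarith
      have : 8 * d * Real.log (1 + δ) ≤ 8 * d * δ := by gcongr
      rw [add_sub_cancel_left]
      linarith
  · obtain ⟨κ, rfl⟩ : ∃ κ, δ = -κ := ⟨-δ, by ring⟩
    have h0 : 0 ≤ κ := by linarith
    rw [abs_neg, abs_of_nonneg h0] at hδ hviol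
    have hκ : κ ≤ 1 / 12 := by nlinarith
    have hmono : ((B.dilate (1 + -κ)).card : ℝ) ≤ N := by
      rw [hN]
      refine Nat.cast_le.2 (Finset.card_le_card (bohrPts_mono ?_))
      nlinarith
    have hlow : ((B.dilate (1 + -κ)).card : ℝ) / N < 1 - 12 * d * κ := by
      by_contra! hge
      have := hviol hge
      rw [lt_div_iff₀ hNpos] at this
      have : 0 ≤ 12 * d * κ * N := by positivity
      nlinarith
    have hcpos : (0 : ℝ) < (B.dilate (1 + -κ)).card := by
      exact_mod_cast card_bohrPts_pos (by nlinarith)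
    have hκpos : 0 < κ := by
      rcases h0.eq_or_lt with h | h
      · rw [← h] at hlow
        have : B.dilate (1 + -0) = B.points := by
          rw [B.dilate_eq, B.points_eq]; simp
        rw [this, ← hN, div_self hNpos.ne'] at hlow
        simp at hlow
      · exact h
    have hlogneg := Real.log_neg (by linarith : 0 < 1 + -κ) (by linarith)
    refine ⟨Real.log B.radius + Real.log (1 + -κ), Real.log B.radius, by linarith, by linarith,
      le_rfl, ?_, ?_, ?_⟩
    · have := Real.log_le_log (by norm_num) (by linarith : 11 / 12 ≤ 1 + -κ)
      linarith
    · have := Real.log_pos (by norm_num : (1:ℝ) < 13 / 12)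
      linarith
    · rw [hpts1, ← hpts _ (by linarith), ← hN]
      have hq : 0 < ((B.dilate (1 + -κ)).card : ℝ) / N := by positivity
      have e1 : Real.log ((B.dilate (1 + -κ)).card / N) ≤ -(12 * d * κ) := by
        have := Real.log_le_sub_one_of_pos hq
        linarith
      rw [Real.log_div hcpos.ne' hNpos.ne'] at e1
      have e4 : - Real.log (1 + -κ) ≤ 12 / 11 * κ := by
        rw [← Real.log_inv]
        have := Real.log_le_sub_one_of_pos (inv_pos.2 (by linarith : 0 < 1 + -κ))
        refine this.trans ?_
        rw [sub_le_iff_le_add, inv_le_comm₀ (by linarith) (by positivity), inv_le_iff_one_le_mul₀ (by positivity)]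
        nlinarith
      have : 8 * d * (- Real.log (1 + -κ)) ≤ 8 * d * (12 / 11 * κ) := by gcongr
      have : 0 ≤ d * κ := by positivity
      nlinarith

theorem isRegular_of_radius_eq_zero (B : BohrSet G) (h : B.radius = 0) : B.IsRegular := by
  intro δ hδ
  have : B.dilate (1 + δ) = B.points := by rw [B.dilate_eq, B.points_eq, h, mul_zero]
  have hN : (0:ℝ) < B.points.card := by exact_mod_cast card_bohrPts_pos B.radius_nonneg
  rw [this, div_self hN.ne']
  have : 0 ≤ 12 * (B.rank : ℝ) * |δ| := by positivity
  constructor <;> linarith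

theorem isRegular_of_rank_eq_zero (B : BohrSet G) (h : B.rank = 0) : B.IsRegular := by
  intro δ hδ
  have hc : B.chars = ∅ := Finset.card_eq_zero.1 h
  have : B.dilate (1 + δ) = B.points := by
    ext x; rw [B.dilate_eq, B.points_eq, mem_bohrPts, mem_bohrPts, hc]; simp
  have hN : (0:ℝ) < B.points.card := by exact_mod_cast card_bohrPts_pos B.radius_nonneg
  rw [this, div_self hN.ne', h]
  simp

/-- Regular radii exist in every dyadic range of small radii. -/
theorem exists_isRegular (Γ : Finset (AddChar G ℂ)) {r : ℝ} (hr : 0 ≤ r) (hr6 : r ≤ 1 / 6) :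
    ∃ B : BohrSet G, B.chars = Γ ∧ r / 2 ≤ B.radius ∧ B.radius ≤ r ∧ B.IsRegular := by
  -- The logarithmic scale needs a positive radius, and the contradiction a positive rank; both
  -- degenerate cases are trivially regular.
  rcases hr.eq_or_lt with rfl | hr
  · exact ⟨⟨Γ, 0, le_rfl⟩, rfl, by simp, le_rfl, isRegular_of_radius_eq_zero _ rfl⟩
  rcases Nat.eq_zero_or_pos Γ.card with h0 | hd
  · exact ⟨⟨Γ, r, hr.le⟩, rfl, by simpa using hr.le, le_rfl, isRegular_of_rank_eq_zero _ h0⟩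
  by_contra! hcon
  have hd1 : (1 : ℝ) ≤ Γ.card := by exact_mod_cast hd
  have l1 := Real.log_neg (by norm_num : (0:ℝ) < 11 / 12) (by norm_num)
  have l2 := Real.log_pos (by norm_num : (1:ℝ) < 13 / 12)
  have l3 : Real.log (r / 2) ≤ Real.log r := Real.log_le_log (by positivity) (by linarith)
  have hpos : ∀ t : ℝ, (0:ℝ) < (bohrPts Γ (Real.exp t)).card := fun t => by
    exact_mod_cast card_bohrPts_pos (Real.exp_pos t).le
  have hf : Monotone fun t : ℝ => Real.log (bohrPts Γ (Real.exp t)).card := by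
    intro s t hst
    refine Real.log_le_log (hpos s) (Nat.cast_le.2 (Finset.card_le_card (bohrPts_mono ?_)))
    exact Real.exp_le_exp.2 hst
  have key := slope_mul_length_le_increment hf (a := Real.log (r / 2) + Real.log (11 / 12))
    (b := Real.log r + Real.log (13 / 12)) (p := Real.log (r / 2)) (q := Real.log r)
    (c := 8 * Γ.card) (by positivity) (by linarith) (by
      intro s hs
      have hs1 : r / 2 ≤ Real.exp s := by
        have := Real.exp_le_exp.2 hs.1; rwa [Real.exp_log (by positivity)] at this
      have hs2 : Real.exp s ≤ r := by
        have := Real.exp_le_exp.2 hs.2; rwa [Real.exp_log hr] at this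
      obtain ⟨l, u, h1, h2, h3, h4, h5, h6⟩ := exists_growth_interval_of_not_isRegular
        ⟨Γ, Real.exp s, (Real.exp_pos s).le⟩ hd (Real.exp_pos s) (hcon _ rfl hs1 hs2)
      simp only [Real.log_exp] at h2 h3 h4 h5
      exact ⟨l, u, h1, h2, h3, by linarith [hs.1], by linarith [hs.2], h6⟩)
  have e1 : Real.exp (Real.log r + Real.log (13 / 12)) = 13 / 12 * r := by
    rw [Real.exp_add, Real.exp_log hr, Real.exp_log (by norm_num), mul_comm]
  -- `11/26` is the ratio of the ends `11/12 * (r/2)` and `13/12 * r` of the range of radii; `r ≤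
  -- 1/6` keeps the upper end below `1/5`.
  have e2 : Real.exp (Real.log (r / 2) + Real.log (11 / 12)) = 11 / 26 * (13 / 12 * r) := by
    rw [Real.exp_add, Real.exp_log (by positivity), Real.exp_log (by norm_num)]; ring
  have hdbl : Real.log (bohrPts Γ (Real.exp (Real.log r + Real.log (13 / 12)))).card ≤
      Γ.card * Real.log 5 +
        Real.log (bohrPts Γ (Real.exp (Real.log (r / 2) + Real.log (11 / 12)))).card := by
    rw [← Real.log_pow, ← Real.log_mul (by positivity) (hpos _).ne']
    refine Real.log_le_log (hpos _) ?_
    rw [e1, e2]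
    exact_mod_cast card_bohrPts_le_five_pow_mul (Γ := Γ) (by positivity : 0 < 13 / 12 * r) (by linarith)
  have l5 : Real.log r - Real.log (r / 2) = Real.log 2 := by
    rw [Real.log_div hr.ne' (by norm_num)]; ring
  rw [l5] at key
  -- This is `5^3 ≤ 2^7`. Now `16/5 * 7/3 = 112/15 < 8`, which contradicts the slope `8 * d` over a
  -- length `log 2`.
  have h8 : Real.log 5 ≤ 7 / 3 * Real.log 2 := by
    have : 3 * Real.log 5 ≤ 7 * Real.log 2 := by
      rw [show (3:ℝ) = ((3:ℕ):ℝ) by norm_num, show (7:ℝ) = ((7:ℕ):ℝ) by norm_num, ← Real.log_pow,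
        ← Real.log_pow]
      exact Real.log_le_log (by norm_num) (by norm_num)
    linarith
  have hlog2 := Real.log_pos (by norm_num : (1:ℝ) < 2)
  have : 8 * (Γ.card : ℝ) * Real.log 2 ≤ 16 / 5 * (Γ.card * (7 / 3 * Real.log 2)) := by
    refine key.trans ?_
    gcongr
    have : (Γ.card:ℝ) * Real.log 5 ≤ Γ.card * (7 / 3 * Real.log 2) := by gcongr
    linarith
  have : 0 < (Γ.card : ℝ) * Real.log 2 := by positivity
  nlinarith

end Bohr

/-! ### Chang's theorem relative to a regular Bohr set. -/

section CharMean

variable {G : Type*} [AddCommGroup G] [Fintype G]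

/-- The mean value of a character on a finite set, i.e. a Fourier coefficient of `μ_X`. -/
noncomputable def charMean (X : Finset G) (γ : AddChar G ℂ) : ℂ := (∑ x ∈ X, γ x) / X.card

theorem norm_charMean_le_one (X : Finset G) (γ : AddChar G ℂ) : ‖charMean X γ‖ ≤ 1 := by
  rw [charMean, norm_div, Complex.norm_natCast]
  refine div_le_one_of_le₀ ((norm_sum_le _ _).trans ?_) (by positivity)
  simp [AddChar.norm_apply]

theorem charMean_neg (X : Finset G) (γ : AddChar G ℂ) :
    (∑ x ∈ X, γ (-x)) / X.card = (starRingEnd ℂ) (charMean X γ) := by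
  simp [charMean, AddChar.map_neg_eq_conj]

theorem AddChar.norm_add_apply_sub_one_le (χ ψ : AddChar G ℂ) (t : G) :
    ‖(χ + ψ) t - 1‖ ≤ ‖χ t - 1‖ + ‖ψ t - 1‖ := by
  have h : (χ + ψ) t - 1 = ψ t * (χ t - 1) + (ψ t - 1) := by
    rw [AddChar.add_apply]; ring
  rw [h]
  refine (norm_add_le _ _).trans ?_
  rw [norm_mul, AddChar.norm_apply, one_mul]

theorem AddChar.norm_neg_apply_sub_one (χ : AddChar G ℂ) (t : G) :
    ‖(-χ) t - 1‖ = ‖χ t - 1‖ := by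
  rw [AddChar.neg_apply, AddChar.norm_map_neg_sub_one]

theorem AddChar.norm_sum_apply_sub_one_le {ι : Type*} (s : Finset ι) (χ : ι → AddChar G ℂ) (t : G) :
    ‖(∑ i ∈ s, χ i) t - 1‖ ≤ ∑ i ∈ s, ‖χ i t - 1‖ := by
  classical
  induction s using Finset.induction_on with
  | empty => simp
  | insert i s hi ih =>
    rw [Finset.sum_insert hi, Finset.sum_insert hi]
    exact (AddChar.norm_add_apply_sub_one_le _ _ _).trans (by gcongr)

/-- The coefficients allowed in the definition of dissociativity. -/
def signs : Finset ℤ := {-1, 0, 1}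

theorem AddChar.norm_zsmul_apply_sub_one_le {e : ℤ} (he : e ∈ signs) (χ : AddChar G ℂ) (t : G) :
    ‖(e • χ) t - 1‖ ≤ ‖χ t - 1‖ := by
  simp only [signs, Finset.mem_insert, Finset.mem_singleton] at he
  rcases he with rfl | rfl | rfl
  · rw [neg_one_zsmul, AddChar.norm_neg_apply_sub_one]
  · simp
  · simp

omit [Fintype G] in
theorem AddChar.sum_zsmul_apply {ι : Type*} (s : Finset ι) (χ : ι → AddChar G ℂ) (e : ι → ℤ)
    (t : G) : (∑ i ∈ s, e i • χ i) t = ∏ i ∈ s, χ i t ^ e i := by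
  rw [AddChar.sum_apply]
  exact Finset.prod_congr rfl fun i _ => by
    rw [AddChar.zsmul_apply]

/-- A Riesz product bound: dissociated families of large Fourier coefficients are small. Here
dissociativity enters through the smallness of the Fourier coefficients of the weight `w` at
nontrivial combinations of the family. -/
theorem exp_card_mul_card_le {ι : Type*} [Fintype ι] [DecidableEq ι] (lam : ι → AddChar G ℂ)
    (X : Finset G) (w : G → ℝ) (W : ℝ) (hw : ∀ x, 0 ≤ w x) (hwX : ∀ x ∈ X, 1 ≤ w x)
    (hW : ∑ x, w x ≤ W)
    (hsmall : ∀ e : ι → ℤ, (∀ i, e i ∈ signs) → e ≠ 0 →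
      ‖∑ x, (w x : ℂ) * (∑ i, e i • lam i) x‖ ≤ (1 / 2) ^ Fintype.card ι * W)
    (hbig : ∀ i, 1 / 2 * (X.card : ℝ) ≤ ‖∑ x ∈ X, lam i x‖) :
    Real.exp (Fintype.card ι / 8) * X.card ≤ 2 * W := by
  -- The phases `u i` rotate the character sums onto the nonnegative reals.
  choose u hu1 hu2 using fun i => RCLike.exists_norm_eq_mul_self (∑ x ∈ X, lam i x)
  set n := Fintype.card ι with hn
  have hW0 : 0 ≤ W := (Finset.sum_nonneg fun x _ => hw x).trans hW
  let y : ι → G → ℝ := fun i x => (u i * lam i x).re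
  have hy : ∀ i x, |y i x| ≤ 1 := fun i x => by
    refine (Complex.abs_re_le_norm _).trans ?_
    rw [norm_mul, hu1, AddChar.norm_apply, one_mul]
  have hysum : ∀ i, 1 / 2 * (X.card : ℝ) ≤ ∑ x ∈ X, y i x := by
    intro i
    have h1 : ((‖∑ x ∈ X, lam i x‖ : ℝ) : ℂ) = ∑ x ∈ X, u i * lam i x := by
      rw [← Finset.mul_sum]; exact hu2 i
    have h2 := congrArg Complex.re h1
    rw [Complex.ofReal_re, Complex.re_sum] at h2
    rw [← h2]; exact hbig i
  -- The Riesz factor is the chord of `exp (y/2)` over `[-1, 1]`: it dominates the exponential and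
  -- is linear in the character.
  let p : ι → G → ℝ := fun i x => Real.cosh (1 / 2) + y i x * Real.sinh (1 / 2)
  have hp : ∀ i x, Real.exp (y i x * (1 / 2)) ≤ p i x := fun i x =>
    Real.exp_mul_le_cosh_add_mul_sinh (hy i x) _
  have hp0 : ∀ i x, 0 ≤ p i x := fun i x => (Real.exp_pos _).le.trans (hp i x)
  -- lower bound by convexity
  have hlow : Real.exp (n / 4) * X.card ≤ ∑ x ∈ X, ∏ i, p i x := by
    have h1 : ∀ x ∈ X, Real.exp (n / 4) * (1 + ((∑ i, y i x) / 2 - n / 4)) ≤ ∏ i, p i x := by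
      intro x _
      calc _ ≤ Real.exp (n / 4) * Real.exp ((∑ i, y i x) / 2 - n / 4) := by
            gcongr
            rw [add_comm]
            exact Real.add_one_le_exp _
        _ = ∏ i, Real.exp (y i x * (1 / 2)) := by
            rw [← Real.exp_add, ← Real.exp_sum, ← Finset.sum_mul]
            congr 1; ring
        _ ≤ _ := Finset.prod_le_prod (fun i _ => (Real.exp_pos _).le) fun i _ => hp i x
    refine le_trans ?_ (Finset.sum_le_sum h1)
    rw [← Finset.mul_sum]
    gcongr
    have h2 : (n : ℝ) * (1 / 2 * X.card) ≤ ∑ x ∈ X, ∑ i, y i x := by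
      rw [Finset.sum_comm]
      calc (n : ℝ) * (1 / 2 * X.card) = ∑ _i : ι, (1 / 2 * (X.card : ℝ)) := by simp [hn]
        _ ≤ _ := Finset.sum_le_sum fun i _ => hysum i
    rw [Finset.sum_add_distrib, Finset.sum_sub_distrib, ← Finset.sum_div]
    simp only [Finset.sum_const, nsmul_eq_mul]
    linarith
  -- upper bound by expanding the product
  let c : ι → ℤ → ℂ := fun i j => if j = 0 then (Real.cosh (1 / 2) : ℂ) else
    if j = 1 then Real.sinh (1 / 2) * u i / 2 else Real.sinh (1 / 2) * (starRingEnd ℂ) (u i) / 2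
  have hsinh : 0 ≤ Real.sinh (1 / 2) := Real.sinh_nonneg_iff.2 (by norm_num)
  have hcosh : 0 ≤ Real.cosh (1 / 2) := (Real.cosh_pos _).le
  have hpc : ∀ i x, (p i x : ℂ) = ∑ j ∈ signs, c i j * lam i x ^ j := by
    intro i x
    have hinv : (lam i x)⁻¹ = (starRingEnd ℂ) (lam i x) := by
      rw [← AddChar.map_neg_eq_conj, AddChar.map_neg_eq_inv]
    have hre : ((y i x : ℝ) : ℂ) = (u i * lam i x + (starRingEnd ℂ) (u i * lam i x)) / 2 :=
      Complex.re_eq_add_conj _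
    simp only [signs, p]
    rw [Finset.sum_insert (by decide), Finset.sum_insert (by decide), Finset.sum_singleton]
    simp only [c]
    norm_num
    rw [hinv]
    have := hre
    simp only [map_mul] at this
    rw [this]
    ring
  have hcsum : ∀ i, ∑ j ∈ signs, ‖c i j‖ = Real.exp (1 / 2) := by
    intro i
    have h1 : ‖c i (-1)‖ = Real.sinh (1 / 2) / 2 := by
      simp only [c]
      norm_num [hu1, abs_of_nonneg hsinh, -Complex.ofReal_sinh, Complex.norm_real]
    have h2 : ‖c i 0‖ = Real.cosh (1 / 2) := by
      simp only [c, if_true]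
      rw [Complex.norm_real, Real.norm_eq_abs, abs_of_nonneg hcosh]
    have h3 : ‖c i 1‖ = Real.sinh (1 / 2) / 2 := by
      simp only [c]
      norm_num [hu1, abs_of_nonneg hsinh, -Complex.ofReal_sinh, Complex.norm_real]
    simp only [signs]
    rw [Finset.sum_insert (by decide), Finset.sum_insert (by decide), Finset.sum_singleton, h1, h2,
      h3, ← Real.cosh_add_sinh]
    ring
  have hexpand : ((∑ x, w x * ∏ i, p i x : ℝ) : ℂ) = ∑ e ∈ Fintype.piFinset fun _ : ι => signs,
      (∏ i, c i (e i)) * ∑ x, (w x : ℂ) * (∑ i, e i • lam i) x := by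
    simp only [Complex.ofReal_sum, Complex.ofReal_mul, Complex.ofReal_prod]
    simp_rw [hpc, Finset.prod_univ_sum, Finset.mul_sum]
    rw [Finset.sum_comm]
    refine Finset.sum_congr rfl fun e _ => Finset.sum_congr rfl fun x _ => ?_
    rw [AddChar.sum_zsmul_apply, Finset.prod_mul_distrib]
    ring
  -- Only `e = 0` escapes `hsmall`. All other terms together cost at most `exp (1/2) ^ n * (1/2) ^ n
  -- * W ≤ W`, because `√e ≤ 2`.
  have hterm : ∀ e ∈ Fintype.piFinset fun _ : ι => signs,
      ‖(∏ i, c i (e i)) * ∑ x, (w x : ℂ) * (∑ i, e i • lam i) x‖ ≤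
        (∏ i, ‖c i (e i)‖) * ((1 / 2) ^ n * W) + if e = 0 then Real.cosh (1 / 2) ^ n * W else 0 := by
    intro e he
    have he' := fun i => Fintype.mem_piFinset.1 he i
    rw [norm_mul, norm_prod]
    split_ifs with h0
    · have h1 : ‖∑ x, (w x : ℂ) * (∑ i, e i • lam i) x‖ ≤ W := by
        refine (norm_sum_le _ _).trans (le_trans (le_of_eq ?_) hW)
        refine Finset.sum_congr rfl fun x _ => ?_
        rw [norm_mul, AddChar.norm_apply, mul_one, Complex.norm_real, Real.norm_eq_abs,
          abs_of_nonneg (hw x)]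
      have h2 : ∏ i, ‖c i (e i)‖ = Real.cosh (1 / 2) ^ n := by
        rw [h0]
        simp only [c, Pi.zero_apply, if_true]
        rw [Complex.norm_real, Real.norm_eq_abs, abs_of_nonneg hcosh]
        simp [hn]
      rw [h2]
      have : Real.cosh (1 / 2) ^ n * ‖∑ x, (w x : ℂ) * (∑ i, e i • lam i) x‖ ≤
        Real.cosh (1 / 2) ^ n * W := by gcongr
      have : 0 ≤ Real.cosh (1 / 2) ^ n * ((1 / 2) ^ n * W) := by positivity
      linarith
    · rw [add_zero]
      gcongr
      exact hsmall e he' h0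
  have hup : ∑ x, w x * ∏ i, p i x ≤
      Real.exp (1 / 2) ^ n * ((1 / 2) ^ n * W) + Real.cosh (1 / 2) ^ n * W := by
    have h0 : 0 ≤ ∑ x, w x * ∏ i, p i x :=
      Finset.sum_nonneg fun x _ => mul_nonneg (hw x) (Finset.prod_nonneg fun i _ => hp0 i x)
    have h1 : ∑ x, w x * ∏ i, p i x = ‖((∑ x, w x * ∏ i, p i x : ℝ) : ℂ)‖ := by
      rw [Complex.norm_real, Real.norm_eq_abs, abs_of_nonneg h0]
    rw [h1, hexpand]
    refine (norm_sum_le _ _).trans ((Finset.sum_le_sum hterm).trans ?_)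
    rw [Finset.sum_add_distrib, ← Finset.sum_mul, ← Finset.prod_univ_sum (fun _ => signs)
      (fun i j => ‖c i j‖)]
    simp only [hcsum]
    rw [Finset.sum_ite_eq']
    simp only [Finset.prod_const, Finset.card_univ, ← hn]
    split_ifs
    · exact le_rfl
    · have : 0 ≤ Real.cosh (1 / 2) ^ n * W := by positivity
      linarith
  have hX : ∑ x ∈ X, ∏ i, p i x ≤ ∑ x, w x * ∏ i, p i x := by
    calc ∑ x ∈ X, ∏ i, p i x ≤ ∑ x ∈ X, w x * ∏ i, p i x :=
          Finset.sum_le_sum fun x hx =>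
            le_mul_of_one_le_left (Finset.prod_nonneg fun i _ => hp0 i x) (hwX x hx)
      _ ≤ _ := Finset.sum_le_sum_of_subset_of_nonneg (Finset.subset_univ _) fun x _ _ =>
            mul_nonneg (hw x) (Finset.prod_nonneg fun i _ => hp0 i x)
  have hc1 : Real.cosh (1 / 2) ^ n ≤ Real.exp (n / 8) := by
    calc Real.cosh (1 / 2) ^ n ≤ Real.exp ((1 / 2) ^ 2 / 2) ^ n := by
          gcongr; exact Real.cosh_le_exp_half_sq _
      _ = _ := by rw [← Real.exp_nat_mul]; congr 1; ring
  have hc2 : Real.exp (1 / 2) ^ n * (1 / 2) ^ n ≤ Real.exp (n / 8) := by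
    rw [← mul_pow]
    have he : Real.exp (1 / 2) ≤ 2 := by
      have h1 : Real.exp (1 / 2) ^ 2 = Real.exp 1 := by rw [← Real.exp_nat_mul]; norm_num
      have h2 := Real.exp_one_lt_d9
      nlinarith [Real.exp_pos (1 / 2)]
    refine (pow_le_one₀ (by positivity) (by linarith)).trans (Real.one_le_exp (by positivity))
  have hfinal : Real.exp (n / 4) * X.card ≤ Real.exp (n / 8) * (2 * W) := by
    refine hlow.trans (hX.trans (hup.trans ?_))
    rw [← mul_assoc]
    have h1 := mul_le_mul_of_nonneg_right hc1 hW0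
    have h2 := mul_le_mul_of_nonneg_right hc2 hW0
    linarith
  have hsplit : Real.exp ((n : ℝ) / 4) = Real.exp (n / 8) * Real.exp (n / 8) := by
    rw [← Real.exp_add]; congr 1; ring
  rw [hsplit, mul_assoc] at hfinal
  exact le_of_mul_le_mul_left hfinal (Real.exp_pos _)

/-- A weight that majorises the indicator function of a Bohr set and whose Fourier coefficients
are governed by high powers of those of a smaller Bohr set. -/
theorem exists_weight (Γ : Finset (AddChar G ℂ)) {h : ℝ} (hh : 0 ≤ h) (T : ℝ) (L : ℕ) :
    ∀ r, r + L * h = T → ∃ w : G → ℝ, (∀ x, 0 ≤ w x) ∧ (∀ x ∈ bohrPts Γ r, 1 ≤ w x) ∧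
      ∀ γ : AddChar G ℂ, ‖∑ x, (w x : ℂ) * γ x‖ ≤
        (bohrPts Γ T : Finset G).card * ‖charMean (bohrPts Γ h) γ‖ ^ L := by
  classical
  induction L with
  | zero =>
    intro r hr
    have hrT : r = T := by simpa using hr
    refine ⟨fun x => if x ∈ bohrPts Γ T then 1 else 0, fun x => by positivity, fun x hx => ?_, ?_⟩
    · simp [hrT ▸ hx]
    · intro γ
      have : ∑ x, (((if x ∈ bohrPts Γ T then 1 else 0 : ℝ)) : ℂ) * γ x = ∑ x ∈ bohrPts Γ T, γ x := by
        rw [← Finset.sum_subset (Finset.subset_univ (bohrPts Γ T)) (fun x _ hx => by simp [hx])]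
        exact Finset.sum_congr rfl fun x hx => by simp [hx]
      rw [this, pow_zero, mul_one]
      refine (norm_sum_le _ _).trans ?_
      simp [AddChar.norm_apply]
  | succ L ih =>
    intro r hr
    push_cast at hr
    obtain ⟨w, hw0, hw1, hwγ⟩ := ih (r + h) (by linarith)
    set D : Finset G := bohrPts Γ h with hD
    have hDpos : (0 : ℝ) < D.card := by exact_mod_cast card_bohrPts_pos hh
    -- Averaging over `D` multiplies each coefficient by the conjugate of `charMean D γ` and shrinks
    -- by `h` the radius up to which the weight is at least 1.
    refine ⟨fun x => (∑ b ∈ D, w (x + b)) / D.card,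
      fun x => div_nonneg (Finset.sum_nonneg fun b _ => hw0 _) hDpos.le, fun x hx => ?_, fun γ => ?_⟩
    · rw [le_div_iff₀ hDpos, one_mul]
      calc (D.card : ℝ) = ∑ _b ∈ D, (1 : ℝ) := by simp
        _ ≤ _ := Finset.sum_le_sum fun b hb => hw1 _ (add_mem_bohrPts hx hb)
    · have h1 : ∑ x, (((∑ b ∈ D, w (x + b)) / D.card : ℝ) : ℂ) * γ x =
          (∑ b ∈ D, γ (-b)) / D.card * ∑ x, (w x : ℂ) * γ x := by
        push_cast
        simp_rw [Finset.sum_div, Finset.sum_mul]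
        rw [Finset.sum_comm]
        refine Finset.sum_congr rfl fun b _ => ?_
        rw [Finset.mul_sum]
        refine Fintype.sum_equiv (Equiv.addRight b) _ _ fun x => ?_
        simp only [Equiv.coe_addRight]
        rw [AddChar.map_add_eq_mul, AddChar.map_neg_eq_inv]
        have : γ b ≠ 0 := norm_ne_zero_iff.1 (by simp [AddChar.norm_apply])
        field_simp
      rw [h1, charMean_neg, norm_mul, RCLike.norm_conj, pow_succ]
      calc _ ≤ ‖charMean D γ‖ * ((bohrPts Γ T : Finset G).card * ‖charMean D γ‖ ^ L) := by
            gcongr; exact hwγ γ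
        _ = _ := by ring

open Classical in
/-- Characters with a large Fourier coefficient on a regular Bohr set are almost constant on
a smaller Bohr set. -/
theorem norm_apply_sub_one_le_of_isRegular {B : BohrSet G} (hB : B.IsRegular) {δ : ℝ}
    (hδ0 : 0 ≤ δ) (hδ : 12 * (B.rank : ℝ) * δ ≤ 1) {χ : AddChar G ℂ}
    (hχ : 1 / 2 ≤ ‖charMean B.points χ‖) {t : G} (ht : t ∈ bohrPts B.chars (δ * B.radius)) :
    ‖χ t - 1‖ ≤ 48 * B.rank * δ := by
  have hpos : (0 : ℝ) < B.points.card := by exact_mod_cast card_bohrPts_pos B.radius_nonneg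
  set D := B.points with hD
  set D' := D.image (fun y => y + t) with hD'
  have hinj : Function.Injective fun y : G => y + t := add_left_injective t
  have hcard : D'.card = D.card := Finset.card_image_of_injective _ hinj
  have hdil : ((B.dilate (1 + δ)).card : ℝ) ≤ (1 + 12 * B.rank * δ) * D.card := by
    have := (hB δ (by rwa [abs_of_nonneg hδ0])).2
    rwa [abs_of_nonneg hδ0, div_le_iff₀ hpos] at this
  have hsub1 : D' ⊆ B.dilate (1 + δ) := by
    intro z hz
    obtain ⟨y, hy, rfl⟩ := Finset.mem_image.1 hz
    rw [B.dilate_eq, add_mul, one_mul]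
    exact add_mem_bohrPts hy ht
  have hsub2 : D ⊆ B.dilate (1 + δ) := bohrPts_mono (by nlinarith [B.radius_nonneg])
  have hdiff1 : ((D' \ D).card : ℝ) ≤ 12 * B.rank * δ * D.card := by
    have h1 : (D' \ D).card + D.card ≤ (B.dilate (1 + δ)).card := by
      rw [← Finset.card_union_of_disjoint Finset.sdiff_disjoint]
      exact Finset.card_le_card (Finset.union_subset (Finset.sdiff_subset.trans hsub1) hsub2)
    have h2 : ((D' \ D).card : ℝ) + D.card ≤ (B.dilate (1 + δ)).card := by exact_mod_cast h1
    linarith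
  have hdiff2 : (D \ D').card = (D' \ D).card := Finset.card_sdiff_comm hcard.symm
  -- Translation by `t` only changes `D` near its boundary: two pieces of size at most `12 d δ |D|`
  -- each, against a sum of size at least `|D|/2`, whence the constant 48.
  have hid : (χ t - 1) * ∑ y ∈ D, χ y = ∑ y ∈ D' \ D, χ y - ∑ y ∈ D \ D', χ y := by
    have h1 : ∑ y ∈ D', χ y = χ t * ∑ y ∈ D, χ y := by
      rw [hD', Finset.sum_image hinj.injOn, Finset.mul_sum]
      exact Finset.sum_congr rfl fun y _ => by rw [AddChar.map_add_eq_mul, mul_comm]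
    rw [Finset.sum_sdiff_sub_sum_sdiff, h1]
    ring
  have hle : ‖χ t - 1‖ * ‖∑ y ∈ D, χ y‖ ≤ 2 * (12 * B.rank * δ * D.card) := by
    rw [← norm_mul, hid]
    refine (norm_sub_le _ _).trans ?_
    have h1 : ∀ E : Finset G, ‖∑ y ∈ E, χ y‖ ≤ E.card := fun E =>
      (norm_sum_le _ _).trans (by simp [AddChar.norm_apply])
    have h2 := h1 (D' \ D)
    have h3 := h1 (D \ D')
    rw [hdiff2] at h3
    linarith
  rw [charMean, norm_div, Complex.norm_natCast, le_div_iff₀ hpos] at hχ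
  have h5 : ‖χ t - 1‖ * (1 / 2 * D.card) ≤ 2 * (12 * B.rank * δ * D.card) :=
    le_trans (by gcongr) hle
  have h6 : ‖χ t - 1‖ * D.card ≤ (48 * B.rank * δ) * D.card := by linarith
  exact le_of_mul_le_mul_right h6 hpos

/-- `Λ` has no nontrivial `{-1, 0, 1}`-relations modulo the large spectrum of `D`. -/
def IsDissociatedMod (D : Finset G) (Λ : Finset (AddChar G ℂ)) : Prop :=
  ∀ e : AddChar G ℂ → ℤ, (∀ χ, e χ ∈ signs) → 1 / 2 ≤ ‖charMean D (∑ χ ∈ Λ, e χ • χ)‖ →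
    ∀ χ ∈ Λ, e χ = 0

omit [Fintype G] in
theorem IsDissociatedMod.mono {D : Finset G} {Λ Λ' : Finset (AddChar G ℂ)}
    (h : IsDissociatedMod D Λ) (hsub : Λ' ⊆ Λ) : IsDissociatedMod D Λ' := by
  classical
  intro e he hD χ hχ
  have := h (fun ψ => if ψ ∈ Λ' then e ψ else 0) (fun ψ => by
    split_ifs
    · exact he ψ
    · simp [signs]) (by
    convert hD using 3
    rw [← Finset.sum_subset hsub fun ψ _ hψ => by simp [hψ]]
    exact Finset.sum_congr rfl fun ψ hψ => by simp [hψ]) χ (hsub hχ)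
  simpa [hχ] using this

/-- Apply the Riesz product bound to exactly `N` characters, with the weight averaged `N` times over
the small Bohr set. Nontrivial combinations have mean below `1/2` there, so their coefficients are
at most `(1/2)^N * W`, and regularity gives `W ≤ 2|B|`. Then `exp (N/8) * τ ≤ 4`, contrary to the
choice of `N`. -/
theorem IsDissociatedMod.card_lt {B : BohrSet G} (hB : B.IsRegular) {X : Finset G}
    (hXB : X ⊆ B.points) {τ : ℝ} (hτ : 0 < τ) (hX : τ * B.points.card ≤ X.card) {N : ℕ}
    (hN : 8 * Real.log (4 / τ) < N) {δ : ℝ} (hδ0 : 0 ≤ δ) (hδ : 12 * (B.rank : ℝ) * (N * δ) ≤ 1)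
    {Λ : Finset (AddChar G ℂ)} (hΛX : ∀ χ ∈ Λ, 1 / 2 ≤ ‖charMean X χ‖)
    (hΛ : IsDissociatedMod (bohrPts B.chars (δ * B.radius)) Λ) : Λ.card < N := by
  classical
  by_contra! hcard
  obtain ⟨Λ', hsub, hcard'⟩ := Finset.exists_subset_card_eq hcard
  have hΛ' := hΛ.mono hsub
  have hBpos : (0 : ℝ) < B.points.card := by exact_mod_cast card_bohrPts_pos B.radius_nonneg
  have hXpos : (0 : ℝ) < X.card := lt_of_lt_of_le (by positivity) hX
  obtain ⟨w, hw0, hw1, hwγ⟩ := exists_weight B.chars (mul_nonneg hδ0 B.radius_nonneg)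
    ((1 + N * δ) * B.radius) N B.radius (by ring)
  set W : ℝ := ((bohrPts B.chars ((1 + N * δ) * B.radius) : Finset G).card : ℝ) with hWdef
  have hW : W ≤ 2 * B.points.card := by
    have h0 : 0 ≤ N * δ := by positivity
    have := (hB (N * δ) (by rwa [abs_of_nonneg h0])).2
    rw [abs_of_nonneg h0, div_le_iff₀ hBpos, B.dilate_eq] at this
    refine this.trans ?_
    gcongr
    linarith
  have hWsum : ∑ x, w x ≤ W := by
    have h1 := hwγ 0
    have h2 : ∑ x, (w x : ℂ) * (0 : AddChar G ℂ) x = ((∑ x, w x : ℝ) : ℂ) := by simp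
    rw [h2, Complex.norm_real, Real.norm_eq_abs,
      abs_of_nonneg (Finset.sum_nonneg fun x _ => hw0 x)] at h1
    refine h1.trans (mul_le_of_le_one_right (by positivity) ?_)
    exact pow_le_one₀ (norm_nonneg _) (norm_charMean_le_one _ _)
  have hcardι : Fintype.card Λ' = N := by simp [hcard']
  have key := exp_card_mul_card_le (fun i : Λ' => i.1) X w W hw0 (fun x hx => hw1 x (hXB hx)) hWsum
    (by
      intro e he hne
      refine (hwγ _).trans ?_
      rw [mul_comm, hcardι]
      gcongr
      by_contra! hlt
      refine hne (funext fun i => ?_)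
      let e' : AddChar G ℂ → ℤ := fun χ => if h : χ ∈ Λ' then e ⟨χ, h⟩ else 0
      have he' : ∀ χ, e' χ ∈ signs := fun χ => by
        by_cases h : χ ∈ Λ'
        · simpa [e', h] using he ⟨χ, h⟩
        · simp [e', h, signs]
      have hsum : ∑ χ ∈ Λ', e' χ • χ = ∑ i, e i • i.1 := by
        rw [← Finset.sum_coe_sort Λ']
        exact Finset.sum_congr rfl fun i _ => by simp [e']
      have := hΛ' e' he' (by rw [hsum]; exact hlt.le) i.1 i.2
      simpa [e'] using this)
    (by
      intro i
      have := hΛX i.1 (hsub i.2)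
      rwa [charMean, norm_div, Complex.norm_natCast, le_div_iff₀ hXpos] at this)
  rw [hcardι] at key
  have h1 : Real.exp (N / 8) ≤ 4 / τ := by
    rw [le_div_iff₀ hτ]
    have h2 : Real.exp (N / 8) * (τ * B.points.card) ≤ 4 * B.points.card :=
      calc _ ≤ Real.exp (N / 8) * X.card := by gcongr
        _ ≤ _ := by linarith
    rw [← mul_assoc] at h2
    exact le_of_mul_le_mul_right h2 hBpos
  have h3 := (Real.le_log_iff_exp_le (by positivity)).2 h1
  linarith

/-- Chang's theorem relative to a regular Bohr set: the large spectrum of a dense subset is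
controlled by few characters together with the large spectrum of a smaller Bohr set. -/
theorem exists_control_of_large_spectrum {B : BohrSet G} (hB : B.IsRegular) {X : Finset G}
    (hXB : X ⊆ B.points) {τ : ℝ} (hτ : 0 < τ) (hX : τ * B.points.card ≤ X.card) {N : ℕ}
    (hN : 8 * Real.log (4 / τ) < N) {δ : ℝ} (hδ0 : 0 ≤ δ)
    (hδ : 12 * (B.rank : ℝ) * (N * δ) ≤ 1) :
    ∃ Λ : Finset (AddChar G ℂ), Λ.card ≤ N ∧ ∀ γ, 1 / 2 ≤ ‖charMean X γ‖ →
      ∃ χ, 1 / 2 ≤ ‖charMean (bohrPts B.chars (δ * B.radius)) χ‖ ∧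
        ∀ t, ‖γ t - 1‖ ≤ ‖χ t - 1‖ + ∑ ψ ∈ Λ, ‖ψ t - 1‖ := by
  classical
  set D : Finset G := bohrPts B.chars (δ * B.radius) with hD
  have hDpos : (0 : ℝ) < D.card := by
    exact_mod_cast card_bohrPts_pos (mul_nonneg hδ0 B.radius_nonneg)
  obtain ⟨Λ, hΛ, hmax⟩ := Finset.exists_max_image
    (Finset.univ.filter fun Λ : Finset (AddChar G ℂ) =>
      (∀ χ ∈ Λ, 1 / 2 ≤ ‖charMean X χ‖) ∧ IsDissociatedMod D Λ) Finset.card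
    ⟨∅, by simp [IsDissociatedMod]⟩
  simp only [Finset.mem_filter, Finset.mem_univ, true_and] at hΛ hmax
  refine ⟨Λ, (hΛ.2.card_lt hB hXB hτ hX hN hδ0 hδ hΛ.1).le, fun γ hγ => ?_⟩
  have hzero : 1 / 2 ≤ ‖charMean D 0‖ := by
    rw [charMean]
    simp only [AddChar.zero_apply, Finset.sum_const, nsmul_eq_mul, mul_one]
    rw [div_self (by exact_mod_cast hDpos.ne')]
    norm_num
  by_cases hmem : γ ∈ Λ
  · refine ⟨0, hzero, fun t => ?_⟩
    simp only [AddChar.zero_apply, sub_self, norm_zero, zero_add]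
    exact Finset.single_le_sum (f := fun ψ : AddChar G ℂ => ‖ψ t - 1‖) (fun _ _ => norm_nonneg _) hmem
  have hnot : ¬ IsDissociatedMod D (insert γ Λ) := fun hdis => by
    have := hmax (insert γ Λ) ⟨fun χ hχ => by
      rcases Finset.mem_insert.1 hχ with rfl | h
      · exact hγ
      · exact hΛ.1 χ h, hdis⟩
    rw [Finset.card_insert_of_notMem hmem] at this
    omega
  unfold IsDissociatedMod at hnot
  push Not at hnot
  -- By maximality of `Λ` this relation involves `γ`. Solving for `±γ` gives an element of the
  -- spectrum of `D` minus a `{-1, 0, 1}`-combination of `Λ`.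
  obtain ⟨e, he, hlarge, χ, hχ, hχ0⟩ := hnot
  refine ⟨_, hlarge, fun t => ?_⟩
  rw [Finset.sum_insert hmem] at hlarge ⊢
  have heγ : e γ ≠ 0 := by
    intro h0
    rw [h0, zero_zsmul, zero_add] at hlarge
    rcases Finset.mem_insert.1 hχ with rfl | h
    · exact hχ0 h0
    · exact hχ0 (hΛ.2 e he hlarge χ h)
  have h1 : ‖γ t - 1‖ = ‖(e γ • γ) t - 1‖ := by
    have := he γ
    simp only [signs, Finset.mem_insert, Finset.mem_singleton] at this
    rcases this with h | h | h
    · rw [h, neg_one_zsmul, AddChar.norm_neg_apply_sub_one]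
    · exact absurd h heγ
    · rw [h, one_zsmul]
  have h2 : e γ • γ = (e γ • γ + ∑ ψ ∈ Λ, e ψ • ψ) + -∑ ψ ∈ Λ, e ψ • ψ := by abel
  rw [h1]
  calc ‖(e γ • γ) t - 1‖ ≤ ‖(e γ • γ + ∑ ψ ∈ Λ, e ψ • ψ) t - 1‖ +
        ‖(-∑ ψ ∈ Λ, e ψ • ψ) t - 1‖ := by
        conv_lhs => rw [h2]
        exact AddChar.norm_add_apply_sub_one_le _ _ _
    _ ≤ _ := by
        rw [AddChar.norm_neg_apply_sub_one]
        gcongr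
        refine (AddChar.norm_sum_apply_sub_one_le _ _ _).trans (Finset.sum_le_sum fun ψ _ => ?_)
        exact AddChar.norm_zsmul_apply_sub_one_le (he ψ) ψ t

end CharMean

/-! ### Moments of sums of independent variables. -/

/-- A single term of the power series. Removing the constant term 1 is what lets the moment bound
below be proportional to the variance. -/
theorem Real.pow_div_factorial_le_cosh_sub_one (x : ℝ) {m : ℕ} (hm : 0 < m) :
    x ^ (2 * m) / (2 * m).factorial ≤ Real.cosh x - 1 := by
  have h := sum_le_hasSum {0, m} (fun i _ => by
    have : (0:ℝ) ≤ x ^ (2 * i) := by rw [pow_mul]; positivity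
    positivity) (Real.hasSum_cosh x)
  rw [Finset.sum_pair hm.ne] at h
  simp at h
  linarith

/-- A moment bound for sums of independent bounded centred random variables, linear in the
variance, phrased as a sum over tuples. -/
theorem sum_piFinset_sum_pow_le {α : Type*} (A : Finset α) (X : α → ℝ)
    (hX1 : ∀ a ∈ A, |X a| ≤ 1) (hX0 : ∑ a ∈ A, X a = 0) {v : ℝ} (hv0 : 0 ≤ v) (hv1 : v ≤ 1)
    (hXv : ∑ a ∈ A, X a ^ 2 ≤ v * A.card) {m n : ℕ} (hm : 0 < m) (hmn : m ≤ n) :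
    ∑ p ∈ Fintype.piFinset (fun _ : Fin n => A), (∑ i, X (p i)) ^ (2 * m) ≤
      (A.card : ℝ) ^ n * v * (4 * Real.exp 1 * m * n) ^ m := by
  have hmR : (0 : ℝ) < m := by exact_mod_cast hm
  have hnR : (0 : ℝ) < n := by exact_mod_cast hm.trans_le hmn
  have hmnR : (m : ℝ) ≤ n := by exact_mod_cast hmn
  -- This choice makes `(1 + z^2)^n ≤ e^m`, and the factor `(2m)^{2m} z^{-2m}` becomes `(4mn)^m`.
  set z := √((m : ℝ) / n) with hz
  have hz2 : z ^ 2 = m / n := Real.sq_sqrt (by positivity)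
  have hzpos : 0 < z := Real.sqrt_pos.2 (by positivity)
  have hz1 : z ≤ 1 := by
    exact Real.sqrt_le_one.2 (div_le_one_of_le₀ hmnR hnR.le)
  have hexp : ∀ y : ℝ, |y| ≤ 1 → y ^ 2 = z ^ 2 →
      ∑ p ∈ Fintype.piFinset (fun _ : Fin n => A), Real.exp (y * ∑ i, X (p i)) ≤
        (A.card : ℝ) ^ n * (1 + z ^ 2 * v) ^ n := by
    intro y hy hyz
    have h1 : ∑ a ∈ A, Real.exp (y * X a) ≤ A.card * (1 + z ^ 2 * v) := by
      calc ∑ a ∈ A, Real.exp (y * X a) ≤ ∑ a ∈ A, (1 + y * X a + z ^ 2 * X a ^ 2) := by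
            refine Finset.sum_le_sum fun a ha => ?_
            have h2 : |y * X a| ≤ 1 := by
              rw [abs_mul]
              exact mul_le_one₀ hy (abs_nonneg _) (hX1 a ha)
            have h3 := (abs_le.1 (Real.abs_exp_sub_one_sub_id_le h2)).2
            rw [mul_pow, hyz] at h3
            linarith
        _ = A.card + z ^ 2 * ∑ a ∈ A, X a ^ 2 := by
            rw [Finset.sum_add_distrib, Finset.sum_add_distrib, ← Finset.mul_sum, ← Finset.mul_sum,
              hX0]
            simp
        _ ≤ A.card + z ^ 2 * (v * A.card) := by gcongr
        _ = _ := by ring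
    calc ∑ p ∈ Fintype.piFinset (fun _ : Fin n => A), Real.exp (y * ∑ i, X (p i))
        = (∑ a ∈ A, Real.exp (y * X a)) ^ n := by
          rw [Finset.sum_pow']
          refine Finset.sum_congr rfl fun p _ => ?_
          rw [Finset.mul_sum, Real.exp_sum]
      _ ≤ (A.card * (1 + z ^ 2 * v)) ^ n := by
          gcongr
      _ = _ := mul_pow _ _ _
  -- By convexity in `v`, the power lies below its chord over `[0, 1]`; this produces the factor
  -- `v`.
  have hpow : (1 + z ^ 2 * v) ^ n - 1 ≤ v * Real.exp 1 ^ m := by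
    have h1 := (convexOn_pow n).2 (show (1:ℝ) ∈ Set.Ici 0 by simp)
      (show (1 + z ^ 2) ∈ Set.Ici (0:ℝ) by simp; positivity) (by linarith : 0 ≤ 1 - v) hv0 (by ring)
    simp only [smul_eq_mul, one_pow, mul_one] at h1
    have h2 : (1 + z ^ 2) ^ n ≤ Real.exp 1 ^ m := by
      calc (1 + z ^ 2) ^ n ≤ Real.exp (z ^ 2) ^ n := by
            gcongr
            rw [add_comm]; exact Real.add_one_le_exp _
        _ = Real.exp 1 ^ m := by
            rw [← Real.exp_nat_mul, ← Real.exp_nat_mul, hz2]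
            congr 1; field_simp
    have h3 : 1 - v + v * (1 + z ^ 2) = 1 + z ^ 2 * v := by ring
    rw [h3] at h1
    have h4 : v * (1 + z ^ 2) ^ n ≤ v * Real.exp 1 ^ m := by gcongr
    linarith
  have hcosh : ∑ p ∈ Fintype.piFinset (fun _ : Fin n => A), (Real.cosh (z * ∑ i, X (p i)) - 1) ≤
      (A.card : ℝ) ^ n * (v * Real.exp 1 ^ m) := by
    have h1 := hexp z (by rwa [abs_of_pos hzpos]) rfl
    have h2 := hexp (-z) (by rwa [abs_neg, abs_of_pos hzpos]) (by ring)
    have h3 : ∑ p ∈ Fintype.piFinset (fun _ : Fin n => A), (Real.cosh (z * ∑ i, X (p i)) - 1) =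
        (∑ p ∈ Fintype.piFinset (fun _ : Fin n => A), Real.exp (z * ∑ i, X (p i)) +
        ∑ p ∈ Fintype.piFinset (fun _ : Fin n => A), Real.exp (-z * ∑ i, X (p i))) / 2 -
          (A.card : ℝ) ^ n := by
      simp only [Real.cosh_eq]
      rw [Finset.sum_sub_distrib, ← Finset.sum_div, Finset.sum_add_distrib]
      simp
    have h4 : (A.card : ℝ) ^ n * ((1 + z ^ 2 * v) ^ n - 1) ≤ (A.card : ℝ) ^ n * (v * Real.exp 1 ^ m) := by
      gcongr
    rw [h3]
    linarith
  have hfac : ((2 * m).factorial : ℝ) ≤ (2 * m) ^ (2 * m) := by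
    exact_mod_cast Nat.factorial_le_pow (2 * m)
  have hterm : ∀ p : Fin n → α, (∑ i, X (p i)) ^ (2 * m) ≤
      (4 * m * n) ^ m * (Real.cosh (z * ∑ i, X (p i)) - 1) := by
    intro p
    have h1 := Real.pow_div_factorial_le_cosh_sub_one (z * ∑ i, X (p i)) hm
    have hfpos : (0:ℝ) < (2 * m).factorial := by exact_mod_cast Nat.factorial_pos _
    rw [div_le_iff₀ hfpos, mul_pow] at h1
    have h0 : 0 ≤ Real.cosh (z * ∑ i, X (p i)) - 1 := by linarith [Real.one_le_cosh (z * ∑ i, X (p i))]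
    have h2 : z ^ (2 * m) * (∑ i, X (p i)) ^ (2 * m) ≤
        (Real.cosh (z * ∑ i, X (p i)) - 1) * (2 * m) ^ (2 * m) := h1.trans (by gcongr)
    have h3 : ((2 : ℝ) * m) ^ (2 * m) = z ^ (2 * m) * (4 * m * n) ^ m := by
      rw [pow_mul, pow_mul z, hz2, ← mul_pow]
      congr 1; field_simp; norm_num
    rw [h3] at h2
    have hzp : 0 < z ^ (2 * m) := by positivity
    refine le_of_mul_le_mul_left ?_ hzp
    linarith
  calc _ ≤ ∑ p ∈ Fintype.piFinset (fun _ : Fin n => A),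
        (4 * m * n : ℝ) ^ m * (Real.cosh (z * ∑ i, X (p i)) - 1) :=
        Finset.sum_le_sum fun p _ => hterm p
    _ ≤ (4 * m * n : ℝ) ^ m * ((A.card : ℝ) ^ n * (v * Real.exp 1 ^ m)) := by
        rw [← Finset.mul_sum]; gcongr
    _ = _ := by
        rw [show (4 * Real.exp 1 * m * n : ℝ) = (4 * m * n) * Real.exp 1 by ring, mul_pow]; ring

/-! ### Croot–Sisask almost-periodicity. -/

section CrootSisask

variable {G : Type*} [AddCommGroup G]

open Classical in
/-- The real-valued indicator function. -/
noncomputable def realInd {α : Type*} (X : Finset α) (x : α) : ℝ := if x ∈ X then 1 else 0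

/-- The convolution `1_M * 1_L`, real-valued. -/
noncomputable def realConv (M L : Finset G) (x : G) : ℝ := ∑ y ∈ M, realInd L (x - y)

/-- The convolution `1_A * 1_M * 1_L`, real-valued. -/
noncomputable def realTripleConv (A M L : Finset G) (x : G) : ℝ := ∑ a ∈ A, realConv M L (x - a)

theorem realInd_nonneg {α : Type*} (X : Finset α) (x : α) : 0 ≤ realInd X x := by
  unfold realInd; positivity

theorem realInd_le_one {α : Type*} (X : Finset α) (x : α) : realInd X x ≤ 1 := by
  unfold realInd; split_ifs <;> norm_num

theorem realInd_sq {α : Type*} (X : Finset α) (x : α) : realInd X x ^ 2 = realInd X x := by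
  unfold realInd; split_ifs <;> norm_num

theorem realTripleConv_eq (A M L : Finset G) (x : G) :
    realTripleConv A M L x = ∑ y ∈ M, realConv A L (x - y) := by
  simp only [realTripleConv, realConv]
  rw [Finset.sum_comm]
  exact Finset.sum_congr rfl fun y _ => Finset.sum_congr rfl fun a _ => by
    rw [sub_right_comm]

variable [Fintype G]

theorem sum_realInd {α : Type*} [Fintype α] (X : Finset α) : ∑ x, realInd X x = X.card := by
  simp [realInd]

theorem sum_realConv (A L : Finset G) : ∑ x, realConv A L x = A.card * L.card := by
  unfold realConv
  rw [Finset.sum_comm]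
  have h : ∀ a : G, ∑ x, realInd L (x - a) = L.card := fun a => by
    rw [← sum_realInd L]
    exact Fintype.sum_equiv (Equiv.subRight a) _ _ fun x => rfl
  simp [h]

/-- The average of `∑ x |∑ i 1_L(x - p_i) - n 1_A*1_L(x)/|A||^{2m}` over tuples `p` in `A`. -/
theorem sum_sampling_error_le {A L : Finset G} (hA : A.Nonempty) {m n : ℕ} (hm : 0 < m)
    (hmn : m ≤ n) :
    ∑ p ∈ Fintype.piFinset (fun _ : Fin n => A),
      ∑ x, (∑ i, realInd L (x - p i) - n * (realConv A L x / A.card)) ^ (2 * m) ≤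
      (A.card : ℝ) ^ n * (L.card * (4 * Real.exp 1 * m * n) ^ m) := by
  have hApos : (0 : ℝ) < A.card := by exact_mod_cast hA.card_pos
  have hconv0 : ∀ x, 0 ≤ realConv A L x := fun x => Finset.sum_nonneg fun a _ => realInd_nonneg _ _
  have hconv1 : ∀ x, realConv A L x / A.card ≤ 1 := fun x => by
    rw [div_le_one hApos]
    exact (Finset.sum_le_sum fun a _ => realInd_le_one L (x - a)).trans (by simp)
  rw [Finset.sum_comm]
  have hx : ∀ x, ∑ p ∈ Fintype.piFinset (fun _ : Fin n => A),
      (∑ i, realInd L (x - p i) - n * (realConv A L x / A.card)) ^ (2 * m) ≤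
      (A.card : ℝ) ^ n * (realConv A L x / A.card) * (4 * Real.exp 1 * m * n) ^ m := by
    intro x
    -- For fixed `x` the sampled indicator is a Bernoulli variable of mean `v`, so its variance is
    -- at most `v`; over all `x` these means add up to `|L|`.
    set v := realConv A L x / A.card with hv
    have hv0 : 0 ≤ v := div_nonneg (hconv0 x) hApos.le
    have hvA : v * A.card = ∑ a ∈ A, realInd L (x - a) := div_mul_cancel₀ _ hApos.ne'
    have := sum_piFinset_sum_pow_le A (fun a => realInd L (x - a) - v) (fun a _ => by
      have h1 := realInd_nonneg L (x - a)
      have h2 := realInd_le_one L (x - a)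
      have h3 := hconv1 x
      rw [abs_le]; constructor <;> linarith) (by
      rw [Finset.sum_sub_distrib, ← hvA]; simp [mul_comm]) hv0 (hconv1 x) (by
      have h1 : ∀ a ∈ A, (realInd L (x - a) - v) ^ 2 =
          realInd L (x - a) - 2 * v * realInd L (x - a) + v ^ 2 := fun a _ => by
        rw [sub_sq, realInd_sq]; ring
      rw [Finset.sum_congr rfl h1, Finset.sum_add_distrib, Finset.sum_sub_distrib, ← Finset.mul_sum,
        ← hvA]
      simp only [Finset.sum_const, nsmul_eq_mul]
      nlinarith [mul_nonneg (sq_nonneg v) hApos.le]) hm hmn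
    refine le_trans (le_of_eq ?_) this
    refine Finset.sum_congr rfl fun p _ => ?_
    rw [Finset.sum_sub_distrib]
    simp
  refine (Finset.sum_le_sum fun x _ => hx x).trans (le_of_eq ?_)
  rw [← Finset.sum_mul, ← Finset.mul_sum, ← Finset.sum_div, sum_realConv]
  field_simp

open Classical in
/-- At least half of all tuples in `A` give a good uniform approximation of `1_A * 1_M * 1_L`. -/
theorem exists_good_tuples {A M L : Finset G} (hA : A.Nonempty) (hM : M.Nonempty)
    (hL : L.Nonempty) {m n : ℕ} (hm : 0 < m) (hmn : m ≤ n)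
    (hML : 2 * (L.card : ℝ) ≤ Real.exp 1 ^ m * M.card) {ε : ℝ} (hε : 0 ≤ ε)
    (hn : 4 * Real.exp 1 ^ 2 * m ≤ ε ^ 2 * n) :
    ∃ P ⊆ Fintype.piFinset (fun _ : Fin n => A), (A.card : ℝ) ^ n ≤ 2 * P.card ∧
      ∀ p ∈ P, ∀ x, |∑ i, realConv M L (x - p i) - n * (realTripleConv A M L x / A.card)| ≤
        n * ε * M.card := by
  have hMpos : (0 : ℝ) < M.card := by exact_mod_cast hM.card_pos
  have hLpos : (0 : ℝ) < L.card := by exact_mod_cast hL.card_pos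
  have hmR : (0 : ℝ) < m := by exact_mod_cast hm
  have hnR : (0 : ℝ) < n := by exact_mod_cast hm.trans_le hmn
  set Q : ℝ := L.card * (4 * Real.exp 1 * m * n) ^ m with hQ
  have hQpos : 0 < Q := by positivity
  let err : (Fin n → G) → G → ℝ := fun p x =>
    ∑ i, realInd L (x - p i) - n * (realConv A L x / A.card)
  have herr0 : ∀ p x, 0 ≤ err p x ^ (2 * m) := fun p x => by rw [pow_mul]; positivity
  set Ω := Fintype.piFinset (fun _ : Fin n => A) with hΩ
  have hΩcard : (Ω.card : ℝ) = (A.card : ℝ) ^ n := by simp [hΩ]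
  -- Markov's inequality: at most half of the tuples exceed twice the bound `Q` for the average
  -- error.
  refine ⟨Ω.filter fun p => ∑ x, err p x ^ (2 * m) ≤ 2 * Q, Finset.filter_subset _ _, ?_, ?_⟩
  · have h1 : ∑ p ∈ Ω, ∑ x, err p x ^ (2 * m) ≤ (A.card : ℝ) ^ n * Q :=
      sum_sampling_error_le hA hm hmn
    have h2 : ((Ω.filter fun p => ¬ ∑ x, err p x ^ (2 * m) ≤ 2 * Q).card : ℝ) * (2 * Q) ≤
        ∑ p ∈ Ω, ∑ x, err p x ^ (2 * m) := by
      rw [← nsmul_eq_mul, ← Finset.sum_const]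
      refine le_trans (Finset.sum_le_sum fun p hp => ?_)
        (Finset.sum_le_sum_of_subset_of_nonneg (Finset.filter_subset _ _)
          fun p _ _ => Finset.sum_nonneg fun x _ => herr0 p x)
      exact (not_le.1 (Finset.mem_filter.1 hp).2).le
    have h3 := Finset.card_filter_add_card_filter_not (s := Ω)
      (fun p => ∑ x, err p x ^ (2 * m) ≤ 2 * Q)
    have h4 : ((Ω.filter fun p => ∑ x, err p x ^ (2 * m) ≤ 2 * Q).card : ℝ) +
      (Ω.filter fun p => ¬ ∑ x, err p x ^ (2 * m) ≤ 2 * Q).card = (A.card : ℝ) ^ n := by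
      rw [← hΩcard]; exact_mod_cast h3
    have h5 : ((Ω.filter fun p => ¬ ∑ x, err p x ^ (2 * m) ≤ 2 * Q).card : ℝ) * 2 ≤
        (A.card : ℝ) ^ n := by
      refine le_of_mul_le_mul_right ?_ hQpos
      linarith [h2.trans h1]
    linarith
  · intro p hp x
    have hp2 := (Finset.mem_filter.1 hp).2
    have hid : ∑ i, realConv M L (x - p i) - n * (realTripleConv A M L x / A.card) =
        ∑ y ∈ M, err p (x - y) := by
      simp only [err]
      rw [Finset.sum_sub_distrib, ← Finset.mul_sum, ← Finset.sum_div, ← realTripleConv_eq]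
      congr 1
      simp only [realConv]
      rw [Finset.sum_comm]
      exact Finset.sum_congr rfl fun y _ => Finset.sum_congr rfl fun a _ => by rw [sub_right_comm]
    rw [hid]
    obtain ⟨k, hk⟩ : ∃ k, 2 * m = k + 1 := ⟨2 * m - 1, by omega⟩
    -- The power mean inequality over `M` turns the `2m`-th moment into a uniform bound; the factor
    -- `2|L|/|M|` is absorbed by `e^m` through `hML`.
    have h1 := pow_sum_div_card_le_sum_pow (s := M) (f := fun y => |err p (x - y)|)
      (fun y _ => abs_nonneg _) k
    have h2 : ∑ y ∈ M, |err p (x - y)| ^ (k + 1) ≤ 2 * Q := by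
      refine le_trans ?_ hp2
      rw [← hk]
      simp only [pow_mul, sq_abs]
      simp only [← pow_mul]
      calc ∑ y ∈ M, err p (x - y) ^ (2 * m) ≤ ∑ y, err p (x - y) ^ (2 * m) :=
            Finset.sum_le_sum_of_subset_of_nonneg (Finset.subset_univ _) fun y _ _ => herr0 _ _
        _ = _ := Fintype.sum_equiv (Equiv.subLeft x) _ _ fun y => rfl
    have h3 := h1.trans h2
    rw [div_le_iff₀ (by positivity)] at h3
    have h4 : (∑ y ∈ M, |err p (x - y)|) ^ (2 * m) ≤ (n * ε * M.card) ^ (2 * m) := by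
      rw [hk]
      refine h3.trans ?_
      have h5 : 2 * Q * (M.card : ℝ) ^ k ≤
          (Real.exp 1 ^ m * M.card) * (4 * Real.exp 1 * m * n) ^ m * (M.card : ℝ) ^ k := by
        rw [hQ, ← mul_assoc]; gcongr
      refine h5.trans ?_
      calc _ = (4 * Real.exp 1 ^ 2 * m * n) ^ m * (M.card : ℝ) ^ (k + 1) := by
            rw [show (4 * Real.exp 1 ^ 2 * m * n : ℝ) = Real.exp 1 * (4 * Real.exp 1 * m * n) by ring,
              mul_pow (Real.exp 1)]
            ring
        _ ≤ (ε ^ 2 * n * n) ^ m * (M.card : ℝ) ^ (k + 1) := by gcongr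
        _ = _ := by
            rw [mul_pow (n * ε), ← hk, pow_mul (n * ε) 2 m]
            congr 2; ring
    have h6 := le_of_pow_le_pow_left₀ (by omega) (by positivity) h4
    exact (Finset.abs_sum_le_sum_abs _ _).trans h6

open Classical in
/-- Pigeonholing the translates of a dense set of tuples. -/
theorem exists_many_translates [DecidableEq G] {A S : Finset G} (hA : A.Nonempty) {K : ℝ}
    (hK : ((A + S).card : ℝ) ≤ K * A.card) {n : ℕ} {P : Finset (Fin n → G)}
    (hP : P ⊆ Fintype.piFinset (fun _ : Fin n => A)) (hPcard : (A.card : ℝ) ^ n ≤ 2 * P.card) :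
    ∃ z : Fin n → G, (S.card : ℝ) ≤
      2 * K ^ n * (S.filter fun s => (fun i => z i - s) ∈ P).card := by
  rcases S.eq_empty_or_nonempty with rfl | hS
  · exact ⟨0, by simp⟩
  have hApos : (0 : ℝ) < A.card := by exact_mod_cast hA.card_pos
  have hK0 : 0 < K := by
    have : (0 : ℝ) < (A + S).card := by exact_mod_cast (hA.add hS).card_pos
    exact pos_of_mul_pos_left (this.trans_le hK) hApos.le
  set Ω := Fintype.piFinset (fun _ : Fin n => A + S) with hΩ
  -- Double counting of pairs `(z, s)`: each `s` contributes `|P|`, since `P + s` lies in `(A +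
  -- S)^n`.
  have hcount : ∑ z ∈ Ω, (S.filter fun s => (fun i => z i - s) ∈ P).card = S.card * P.card := by
    simp only [Finset.card_filter]
    rw [Finset.sum_comm, ← smul_eq_mul, ← Finset.sum_const]
    refine Finset.sum_congr rfl fun s hs => ?_
    rw [← Finset.card_filter]
    refine Finset.card_bij' (fun z _ => fun i => z i - s) (fun p _ => fun i => p i + s) ?_ ?_ ?_ ?_
    · intro z hz; exact (Finset.mem_filter.1 hz).2
    · intro p hp
      refine Finset.mem_filter.2 ⟨?_, by simpa using hp⟩
      rw [hΩ, Fintype.mem_piFinset]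
      exact fun i => Finset.add_mem_add (Fintype.mem_piFinset.1 (hP hp) i) hs
    · intro z _; simp
    · intro p _; simp
  by_contra! hcon
  have hΩne : Ω.Nonempty := by
    rw [hΩ, Fintype.piFinset_nonempty]; exact fun _ => hA.add hS
  have h1 : ∑ z ∈ Ω, 2 * K ^ n * ((S.filter fun s => (fun i => z i - s) ∈ P).card : ℝ) <
      ∑ _z ∈ Ω, (S.card : ℝ) := Finset.sum_lt_sum_of_nonempty hΩne fun z _ => hcon z
  rw [← Finset.mul_sum] at h1
  have h2 : ∑ z ∈ Ω, ((S.filter fun s => (fun i => z i - s) ∈ P).card : ℝ) = S.card * P.card := by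
    exact_mod_cast hcount
  have hΩcard : (Ω.card : ℝ) ≤ (K * A.card) ^ n := by
    have : (Ω.card : ℝ) = ((A + S).card : ℝ) ^ n := by simp [hΩ]
    rw [this]; gcongr
  rw [h2, Finset.sum_const, nsmul_eq_mul] at h1
  have h3 : (Ω.card : ℝ) * S.card ≤ 2 * K ^ n * (S.card * P.card) := by
    calc (Ω.card : ℝ) * S.card ≤ (K ^ n * A.card ^ n) * S.card := by
          rw [← mul_pow]; gcongr
      _ ≤ (K ^ n * (2 * P.card)) * S.card := by gcongr
      _ = _ := by ring
  linarith

/-- Almost-periodicity of `1_A * 1_M * 1_L` along the differences of a large subset of `S`. -/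
theorem exists_almost_periods [DecidableEq G] {A M L S : Finset G} (hA : A.Nonempty)
    (hM : M.Nonempty) (hL : L.Nonempty) {K : ℝ} (hK : ((A + S).card : ℝ) ≤ K * A.card)
    {m n : ℕ} (hm : 0 < m) (hmn : m ≤ n)
    (hML : 2 * (L.card : ℝ) ≤ Real.exp 1 ^ m * M.card) {ε : ℝ} (hε : 0 ≤ ε)
    (hn : 4 * Real.exp 1 ^ 2 * m ≤ ε ^ 2 * n) :
    ∃ T ⊆ S, (S.card : ℝ) ≤ 2 * K ^ n * T.card ∧ ∀ t ∈ T, ∀ t' ∈ T, ∀ x,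
      |realTripleConv A M L (x + (t - t')) - realTripleConv A M L x| ≤
        2 * ε * A.card * M.card := by
  classical
  have hApos : (0 : ℝ) < A.card := by exact_mod_cast hA.card_pos
  have hnR : (0 : ℝ) < n := by exact_mod_cast hm.trans_le hmn
  obtain ⟨P, hP, hPcard, hgood⟩ := exists_good_tuples hA hM hL hm hmn hML hε hn
  obtain ⟨z, hz⟩ := exists_many_translates hA hK hP hPcard
  refine ⟨_, Finset.filter_subset _ _, by convert hz, fun t ht t' ht' x => ?_⟩
  have key : ∀ t, (fun i => z i - t) ∈ P → ∀ x, |∑ i, realConv M L (x - z i) -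
      n * (realTripleConv A M L (x - t) / A.card)| ≤ n * ε * M.card := by
    intro t ht x
    have := hgood _ ht (x - t)
    simpa [sub_sub, add_sub_cancel] using this
  -- Both shifts share the tuple `z`, so the same sampled sum at `x + t` approximates the values at
  -- `x` and at `x + (t - t')`.
  have h1 := key t (Finset.mem_filter.1 ht).2 (x + t)
  have h2 := key t' (Finset.mem_filter.1 ht').2 (x + t)
  rw [add_sub_cancel_right] at h1
  rw [add_sub_assoc x t t'] at h2
  set F1 := realTripleConv A M L (x + (t - t'))
  set F0 := realTripleConv A M L x
  have h4 : |n * (F1 / A.card) - n * (F0 / A.card)| ≤ 2 * (n * ε * M.card) := by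
    rw [abs_le] at h1 h2 ⊢
    constructor <;> linarith [h1.1, h1.2, h2.1, h2.2]
  have h5 : n * (F1 / A.card) - n * (F0 / A.card) = (n / A.card) * (F1 - F0) := by ring
  rw [h5, abs_mul, abs_of_pos (by positivity : (0:ℝ) < n / A.card), div_mul_eq_mul_div,
    div_le_iff₀ hApos] at h4
  refine le_of_mul_le_mul_left ?_ hnR
  linarith

end CrootSisask

/-! ### Fourier expansion and bootstrapping. -/

section Fourier

variable {G : Type*} [AddCommGroup G] [Fintype G]

theorem tripleConv_eq (A M L : Finset G) (x : G) :
    tripleConv A M L x = (realTripleConv A M L x : ℂ) := by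
  have hind : ∀ (X : Finset G) (x : G), setInd X x = (realInd X x : ℂ) := fun X x => by
    by_cases h : x ∈ X <;> simp [setInd, realInd, h]
  have hsum : ∀ (X : Finset G) (f : G → ℂ), ∑ y, setInd X y * f y = ∑ y ∈ X, f y := fun X f => by
    rw [← Finset.sum_subset (Finset.subset_univ X) (fun x _ hx => by simp [setInd, hx])]
    exact Finset.sum_congr rfl fun x hx => by simp [setInd, hx]
  have hassoc : tripleConv A M L x = ∑ a ∈ A, ∑ y ∈ M, setInd L (x - a - y) := by
    simp only [tripleConv, conv, hsum]
    simp_rw [Finset.sum_mul]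
    rw [Finset.sum_comm]
    refine Finset.sum_congr rfl fun a _ => ?_
    rw [← hsum M fun y => setInd L (x - a - y)]
    refine Fintype.sum_equiv (Equiv.subRight a) _ _ fun z => ?_
    simp [sub_sub]
  rw [hassoc]
  simp [realTripleConv, realConv, hind]

/-- Fourier coefficients of indicator functions. -/
noncomputable def hatInd (X : Finset G) (γ : AddChar G ℂ) : ℂ := ∑ x ∈ X, γ (-x)

theorem norm_hatInd_le (X : Finset G) (γ : AddChar G ℂ) : ‖hatInd X γ‖ ≤ X.card :=
  (norm_sum_le _ _).trans (by simp [AddChar.norm_apply])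

theorem realInd_eq_sum_hatInd (X : Finset G) (x : G) :
    (realInd X x : ℂ) = (∑ γ, hatInd X γ * γ x) / Fintype.card G := by
  classical
  have hG : (Fintype.card G : ℂ) ≠ 0 := by exact_mod_cast Fintype.card_ne_zero
  rw [eq_div_iff hG]
  simp only [hatInd, Finset.sum_mul]
  rw [Finset.sum_comm]
  have h : ∀ y : G, ∑ γ : AddChar G ℂ, γ (-y) * γ x = if y = x then (Fintype.card G : ℂ) else 0 := by
    intro y
    simp only [← AddChar.map_add_eq_mul]
    rw [AddChar.sum_apply_eq_ite]
    simp [neg_add_eq_zero]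
  by_cases hx : x ∈ X <;> simp [h, realInd, hx]

theorem sum_norm_hatInd_sq (X : Finset G) :
    ∑ γ, ‖hatInd X γ‖ ^ 2 = Fintype.card G * X.card := by
  classical
  have h : ((∑ γ, ‖hatInd X γ‖ ^ 2 : ℝ) : ℂ) = Fintype.card G * X.card := by
    push_cast
    have h1 : ∀ γ : AddChar G ℂ, (‖hatInd X γ‖ : ℂ) ^ 2 = ∑ x ∈ X, hatInd X γ * γ x := by
      intro γ
      rw [← Complex.mul_conj', ← Finset.mul_sum]
      congr 1
      simp [hatInd, AddChar.map_neg_eq_conj]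
    simp_rw [h1]
    rw [Finset.sum_comm]
    have hG : (Fintype.card G : ℂ) ≠ 0 := by exact_mod_cast Fintype.card_ne_zero
    have h2 : ∀ x, ∑ γ, hatInd X γ * γ x = Fintype.card G * (realInd X x : ℂ) := fun x => by
      rw [realInd_eq_sum_hatInd, mul_div_cancel₀ _ hG]
    simp_rw [h2]
    rw [← Finset.mul_sum]
    congr 1
    rw [Finset.sum_congr rfl (g := fun _ => 1) fun x hx => by simp [realInd, hx]]
    simp
  exact_mod_cast h

/-- The mass bound uses the trivial estimate for the coefficients of `A`, and Cauchy–Schwarz with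
Parseval for those of `M` and `L`. -/
theorem exists_fourier_expansion (A M L : Finset G) : ∃ c : AddChar G ℂ → ℂ,
    (∀ x, tripleConv A M L x = ∑ γ, c γ * γ x) ∧
      ∑ γ, ‖c γ‖ ≤ A.card * √(M.card * L.card) := by
  have hG : (0 : ℝ) < Fintype.card G := by exact_mod_cast Fintype.card_pos
  refine ⟨fun γ => hatInd A γ * hatInd M γ * hatInd L γ / Fintype.card G, fun x => ?_, ?_⟩
  · rw [tripleConv_eq]
    simp only [realTripleConv, realConv, Complex.ofReal_sum, realInd_eq_sum_hatInd]
    simp_rw [← Finset.sum_div, div_mul_eq_mul_div]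
    rw [← Finset.sum_div]
    congr 1
    have h1 : ∀ a ∈ A, ∑ y ∈ M, ∑ γ : AddChar G ℂ, hatInd L γ * γ (x - a - y) =
        ∑ γ : AddChar G ℂ, ∑ y ∈ M, hatInd L γ * γ (x - a - y) := fun a _ => Finset.sum_comm
    rw [Finset.sum_congr rfl h1, Finset.sum_comm]
    refine Finset.sum_congr rfl fun γ _ => ?_
    rw [hatInd.eq_1 A, hatInd.eq_1 M, Finset.sum_mul_sum, Finset.sum_mul, Finset.sum_mul]
    refine Finset.sum_congr rfl fun a _ => ?_
    rw [Finset.sum_mul, Finset.sum_mul]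
    refine Finset.sum_congr rfl fun y _ => ?_
    rw [sub_eq_add_neg, sub_eq_add_neg, AddChar.map_add_eq_mul, AddChar.map_add_eq_mul]
    ring
  · have h1 : ∀ γ : AddChar G ℂ, ‖hatInd A γ * hatInd M γ * hatInd L γ / (Fintype.card G : ℂ)‖ ≤
        A.card / Fintype.card G * (‖hatInd M γ‖ * ‖hatInd L γ‖) := by
      intro γ
      rw [norm_div, norm_mul, norm_mul, Complex.norm_natCast, div_mul_eq_mul_div, mul_assoc]
      gcongr
      exact norm_hatInd_le A γ
    refine (Finset.sum_le_sum fun γ _ => h1 γ).trans ?_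
    rw [← Finset.mul_sum]
    have h2 : ∑ γ, ‖hatInd M γ‖ * ‖hatInd L γ‖ ≤ Fintype.card G * √(M.card * L.card) := by
      refine le_of_sq_le_sq ?_ (by positivity)
      refine (Finset.sum_mul_sq_le_sq_mul_sq _ _ _).trans (le_of_eq ?_)
      rw [sum_norm_hatInd_sq, sum_norm_hatInd_sq, mul_pow, Real.sq_sqrt (by positivity)]
      ring
    calc _ ≤ A.card / Fintype.card G * (Fintype.card G * √(M.card * L.card)) := by gcongr
      _ = _ := by field_simp

/-- Replacing the coefficients `c γ` by `c γ * |μ_T^(γ)| ^ (2 * k)` changes a function that is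
almost periodic along `T - T` only by little. -/
theorem norm_smoothing_sub_le (c : AddChar G ℂ → ℂ) {T : Finset G} (hT : T.Nonempty) {ε : ℝ}
    (hper : ∀ t ∈ T, ∀ t' ∈ T, ∀ x, ‖∑ γ, c γ * γ (x + (t - t')) - ∑ γ, c γ * γ x‖ ≤ ε) (k : ℕ) :
    ∀ x, ‖∑ γ, c γ * ((‖charMean T γ‖ ^ 2 : ℝ) : ℂ) ^ k * γ x - ∑ γ, c γ * γ x‖ ≤ k * ε := by
  have hTpos : (0 : ℝ) < T.card := by exact_mod_cast hT.card_pos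
  have hTne : (T.card : ℂ) ≠ 0 := by exact_mod_cast hT.card_pos.ne'
  -- `F k` is the original function convolved `k` times with `μ_T * μ_{-T}`. Averaging preserves
  -- almost-periodicity, so each of the `k` steps costs at most `ε`.
  let F : ℕ → G → ℂ := fun k x => ∑ γ, c γ * ((‖charMean T γ‖ ^ 2 : ℝ) : ℂ) ^ k * γ x
  have hmean : ∀ γ : AddChar G ℂ, ((‖charMean T γ‖ ^ 2 : ℝ) : ℂ) * (T.card : ℂ) ^ 2 =
      ∑ t ∈ T, ∑ t' ∈ T, γ (t - t') := by
    intro γ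
    have h1 : ∀ t ∈ T, ∑ t' ∈ T, γ (t - t') = γ t * ∑ t' ∈ T, (starRingEnd ℂ) (γ t') := fun t _ => by
      rw [Finset.mul_sum]
      refine Finset.sum_congr rfl fun t' _ => ?_
      rw [sub_eq_add_neg, AddChar.map_add_eq_mul, AddChar.map_neg_eq_conj]
    rw [Finset.sum_congr rfl h1, ← Finset.sum_mul, ← map_sum (starRingEnd ℂ)]
    push_cast
    rw [← Complex.mul_conj', charMean, map_div₀, Complex.conj_natCast]
    field_simp
  have hstep : ∀ k x, F (k + 1) x * (T.card : ℂ) ^ 2 = ∑ t ∈ T, ∑ t' ∈ T, F k (x + (t - t')) := by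
    intro k x
    have h1 : ∀ t ∈ T, ∑ t' ∈ T, F k (x + (t - t')) =
        ∑ γ, ∑ t' ∈ T, c γ * ((‖charMean T γ‖ ^ 2 : ℝ) : ℂ) ^ k * γ (x + (t - t')) :=
      fun t _ => Finset.sum_comm
    rw [Finset.sum_congr rfl h1, Finset.sum_comm]
    simp only [F, Finset.sum_mul]
    refine Finset.sum_congr rfl fun γ _ => ?_
    rw [pow_succ]
    calc c γ * (((‖charMean T γ‖ ^ 2 : ℝ) : ℂ) ^ k * ((‖charMean T γ‖ ^ 2 : ℝ) : ℂ)) * γ x *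
          (T.card : ℂ) ^ 2
        = c γ * ((‖charMean T γ‖ ^ 2 : ℝ) : ℂ) ^ k * γ x *
          (((‖charMean T γ‖ ^ 2 : ℝ) : ℂ) * (T.card : ℂ) ^ 2) := by ring
      _ = _ := by
        rw [hmean, Finset.mul_sum]
        refine Finset.sum_congr rfl fun t _ => ?_
        rw [Finset.mul_sum]
        refine Finset.sum_congr rfl fun t' _ => ?_
        rw [AddChar.map_add_eq_mul]; ring
  have havg : ∀ (E : ℂ) (f : G → G → ℂ) , (∀ t ∈ T, ∀ t' ∈ T, ‖f t t'‖ ≤ ε) →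
      E * (T.card : ℂ) ^ 2 = ∑ t ∈ T, ∑ t' ∈ T, f t t' → ‖E‖ ≤ ε := by
    intro E f hf hE
    have h1 : ‖E‖ * (T.card : ℝ) ^ 2 ≤ ε * (T.card : ℝ) ^ 2 := by
      have h2 : ‖E * (T.card : ℂ) ^ 2‖ = ‖E‖ * (T.card : ℝ) ^ 2 := by simp
      rw [← h2, hE]
      calc _ ≤ ∑ t ∈ T, ∑ t' ∈ T, ‖f t t'‖ :=
            (norm_sum_le _ _).trans (Finset.sum_le_sum fun t _ => norm_sum_le _ _)
        _ ≤ ∑ _t ∈ T, ∑ _t' ∈ T, ε :=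
            Finset.sum_le_sum fun t ht => Finset.sum_le_sum fun t' ht' => hf t ht t' ht'
        _ = _ := by simp; ring
    exact le_of_mul_le_mul_right h1 (by positivity)
  have hF0 : ∀ x, F 0 x = ∑ γ, c γ * γ x := fun x => by simp [F]
  have hperk : ∀ k, ∀ t ∈ T, ∀ t' ∈ T, ∀ x, ‖F k (x + (t - t')) - F k x‖ ≤ ε := by
    intro k
    induction k with
    | zero => simpa only [hF0] using hper
    | succ k ih =>
      intro t ht t' ht' x
      refine havg _ (fun s s' => F k (x + (t - t') + (s - s')) - F k (x + (s - s'))) ?_ ?_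
      · intro s _ s' _
        have := ih t ht t' ht' (x + (s - s'))
        rwa [add_right_comm] at this
      · rw [sub_mul, hstep, hstep]
        simp only [Finset.sum_sub_distrib]
  intro x
  rw [← hF0]
  change ‖F k x - F 0 x‖ ≤ k * ε
  induction k with
  | zero => simp
  | succ k ih =>
    have h1 : ‖F (k + 1) x - F k x‖ ≤ ε := by
      refine havg _ (fun s s' => F k (x + (s - s')) - F k x) (fun s hs s' hs' => hperk k s hs s' hs' x) ?_
      rw [sub_mul, hstep]
      simp only [Finset.sum_sub_distrib, Finset.sum_const, nsmul_eq_mul]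
      ring
    have h2 := norm_sub_le_norm_sub_add_norm_sub (F (k + 1) x) (F k x) (F 0 x)
    push_cast
    linarith

/-- Bootstrapping almost periodicity: from differences of `T` to common approximate kernels of
the large spectrum of `T`. -/
theorem norm_translate_sub_le (c : AddChar G ℂ → ℂ) {T : Finset G} (hT : T.Nonempty) {ε ν : ℝ}
    (hper : ∀ t ∈ T, ∀ t' ∈ T, ∀ x, ‖∑ γ, c γ * γ (x + (t - t')) - ∑ γ, c γ * γ x‖ ≤ ε) (k : ℕ)
    (hν : 0 ≤ ν) {t : G} (ht : ∀ γ, 1 / 2 ≤ ‖charMean T γ‖ → ‖γ t - 1‖ ≤ ν) (x : G) :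
    ‖∑ γ, c γ * γ (x + t) - ∑ γ, c γ * γ x‖ ≤
      2 * (k * ε) + (∑ γ, ‖c γ‖) * (ν + 2 * (1 / 4) ^ k) := by
  have hs := norm_smoothing_sub_le c hT hper k
  set F : G → ℂ := fun x => ∑ γ, c γ * ((‖charMean T γ‖ ^ 2 : ℝ) : ℂ) ^ k * γ x with hF
  have hterm : ∀ γ : AddChar G ℂ, (‖charMean T γ‖ ^ 2) ^ k * ‖γ t - 1‖ ≤ ν + 2 * (1 / 4) ^ k := by
    intro γ
    -- On the large spectrum `t` is an approximate kernel element; off it the damping factor is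
    -- below `(1/4)^k`.
    rcases le_or_gt (1 / 2) ‖charMean T γ‖ with h | h
    · have h1 : (‖charMean T γ‖ ^ 2) ^ k ≤ 1 :=
        pow_le_one₀ (by positivity) (pow_le_one₀ (norm_nonneg _) (norm_charMean_le_one T γ))
      have h2 := mul_le_mul h1 (ht γ h) (norm_nonneg _) zero_le_one
      have : (0:ℝ) ≤ 2 * (1 / 4) ^ k := by positivity
      linarith
    · have h1 : (‖charMean T γ‖ ^ 2) ^ k ≤ (1 / 4) ^ k := by
        gcongr
        nlinarith [norm_nonneg (charMean T γ)]
      have h2 : ‖γ t - 1‖ ≤ 2 := by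
        refine (norm_sub_le _ _).trans ?_
        rw [AddChar.norm_apply, norm_one]; norm_num
      have h3 := mul_le_mul h1 h2 (norm_nonneg _) (by positivity)
      linarith
  have hmid : ‖F (x + t) - F x‖ ≤ (∑ γ, ‖c γ‖) * (ν + 2 * (1 / 4) ^ k) := by
    simp only [hF]
    rw [← Finset.sum_sub_distrib, Finset.sum_mul]
    refine (norm_sum_le _ _).trans (Finset.sum_le_sum fun γ _ => ?_)
    have h1 : c γ * ((‖charMean T γ‖ ^ 2 : ℝ) : ℂ) ^ k * γ (x + t) -
        c γ * ((‖charMean T γ‖ ^ 2 : ℝ) : ℂ) ^ k * γ x =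
        c γ * γ x * (((‖charMean T γ‖ ^ 2 : ℝ) : ℂ) ^ k * (γ t - 1)) := by
      rw [AddChar.map_add_eq_mul]; ring
    rw [h1, norm_mul, norm_mul, AddChar.norm_apply, mul_one, norm_mul, norm_pow, Complex.norm_real,
      Real.norm_eq_abs, abs_of_nonneg (by positivity)]
    gcongr
    exact hterm γ
  have h1 := hs (x + t)
  have h2 := hs x
  rw [norm_sub_rev] at h1
  have h3 := norm_sub_le_norm_sub_add_norm_sub (∑ γ, c γ * γ (x + t)) (F (x + t)) (∑ γ, c γ * γ x)
  have h4 := norm_sub_le_norm_sub_add_norm_sub (F (x + t)) (F x) (∑ γ, c γ * γ x)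
  linarith

/-- The convolution averages the translates `f (x - t)`, and the Bohr set is symmetric. -/
theorem norm_conv_setMu_sub_le {f : G → ℂ} {Γ : Finset (AddChar G ℂ)} {r ε : ℝ} (hr : 0 ≤ r)
    (hε : 0 ≤ ε) (h : ∀ t ∈ bohrPts Γ r, ∀ x, ‖f (x + t) - f x‖ ≤ ε) :
    ‖conv f (setMu (bohrPts Γ r)) - f‖ ≤ ε := by
  rw [pi_norm_le_iff_of_nonneg hε]
  intro x
  have hpos : (0 : ℝ) < (bohrPts Γ r : Finset G).card := by exact_mod_cast card_bohrPts_pos hr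
  set D : Finset G := bohrPts Γ r with hD
  have hne : (D.card : ℂ) ≠ 0 := by exact_mod_cast hpos.ne'
  have h1 : conv f (setMu D) x = (∑ t ∈ D, f (x - t)) / D.card := by
    have h0 : conv f (setMu D) x = ∑ t, f (x - t) * setMu D t :=
      Fintype.sum_equiv (Equiv.subLeft x) _ _ fun y => by simp
    rw [h0, Finset.sum_div, ← Finset.sum_subset (Finset.subset_univ D)
      (fun t _ ht => by simp [setMu, setInd, ht])]
    exact Finset.sum_congr rfl fun t ht => by simp [setMu, setInd, ht, div_eq_mul_inv]
  have h2 : (conv f (setMu D) - f) x = (∑ t ∈ D, (f (x - t) - f x)) / D.card := by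
    rw [Pi.sub_apply, h1, Finset.sum_sub_distrib, sub_div, Finset.sum_const, nsmul_eq_mul,
      mul_div_cancel_left₀ _ hne]
  rw [h2, norm_div, Complex.norm_natCast, div_le_iff₀ hpos]
  refine (norm_sum_le _ _).trans ?_
  calc ∑ t ∈ D, ‖f (x - t) - f x‖ ≤ ∑ _t ∈ D, ε := Finset.sum_le_sum fun t ht => by
        rw [sub_eq_add_neg x]; exact h _ (neg_mem_bohrPts ht) x
    _ = _ := by simp; ring

end Fourier

/-! ### From large spectra to Bohr sets, and the choice of parameters. -/

section Assembly

variable {G : Type*} [AddCommGroup G] [Fintype G]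

/-- The simultaneous approximate kernel of the large spectrum of a dense subset of a regular Bohr
set contains a large regular Bohr set. -/
theorem exists_isRegular_of_large_spectrum {B : BohrSet G} (hB : B.IsRegular) (hB2 : B.radius ≤ 2)
    {X : Finset G} (hXB : X ⊆ B.points) {τ : ℝ} (hτ : 0 < τ)
    (hX : τ * B.points.card ≤ X.card) {N : ℕ} (hN0 : 0 < N) (hN : 8 * Real.log (4 / τ) < N) {ν : ℝ}
    (hν0 : 0 ≤ ν) (hν1 : ν ≤ 1) :
    ∃ B' : BohrSet G, B'.IsRegular ∧ B' ≤ B ∧ B'.rank ≤ B.rank + N ∧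
      B.radius * ν / (4608 * max (B.rank : ℝ) 1 ^ 2 * N) ≤ B'.radius ∧
      ∀ t ∈ B'.points, ∀ γ, 1 / 2 ≤ ‖charMean X γ‖ → ‖γ t - 1‖ ≤ ν := by
  classical
  set ρ := B.radius with hρ
  have hρ0 : 0 ≤ ρ := B.radius_nonneg
  set d := max (B.rank : ℝ) 1 with hd
  have hd1 : 1 ≤ d := le_max_right _ _
  have hdr : (B.rank : ℝ) ≤ d := le_max_left _ _
  have hNR : (1 : ℝ) ≤ N := by exact_mod_cast hN0
  have hdN : 1 ≤ d * N := one_le_mul_of_one_le_of_one_le hd1 hNR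
  have hr0 : ρ / (12 * d * N) ≤ 1 / 6 := by
    rw [div_le_iff₀ (by positivity)]; linarith
  -- `B₁` is the small Bohr set in Chang's theorem: the upper bound on its radius leaves room for
  -- `N` shifts inside `B`, and its own regularity makes the characters in its large spectrum nearly
  -- constant.
  obtain ⟨B₁, hB₁c, hB₁l, hB₁u, hB₁⟩ := exists_isRegular B.chars
    (by positivity : 0 ≤ ρ / (12 * d * N)) hr0
  -- When `ρ = 0` the quotient is 0 by convention, and the radius of `B₁` vanishes too.
  have hδρ : B₁.radius / ρ * ρ = B₁.radius := by
    rcases hρ0.eq_or_lt with h | h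
    · rw [← h] at hB₁u ⊢
      simp at hB₁u ⊢
      exact le_antisymm B₁.radius_nonneg hB₁u
    · exact div_mul_cancel₀ _ h.ne'
  have hδ : 12 * (B.rank : ℝ) * (N * (B₁.radius / ρ)) ≤ 1 := by
    rcases hρ0.eq_or_lt with h | h
    · simp [← h]
    · have h1 : B₁.radius / ρ ≤ 1 / (12 * d * N) := by
        rw [div_le_iff₀ h]
        refine hB₁u.trans (le_of_eq (by ring))
      calc 12 * (B.rank : ℝ) * (N * (B₁.radius / ρ)) ≤ 12 * d * (N * (1 / (12 * d * N))) := by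
            have := div_nonneg B₁.radius_nonneg hρ0
            gcongr
        _ = 1 := by field_simp
  obtain ⟨Λ, hΛ, hspec⟩ := exists_control_of_large_spectrum hB hXB hτ hX hN
    (div_nonneg B₁.radius_nonneg hρ0) hδ
  rw [← hρ, hδρ, ← hB₁c] at hspec
  -- `2304 = 96 * 24`: this is `ν / (96 d)` times the lower bound `ρ / (24 d N)` for the radius of
  -- `B₁`. The spectrum of `B₁` and the sum over `Λ` then each contribute at most `ν/2`.
  set r := ρ * ν / (2304 * d ^ 2 * N) with hr
  have hrpos : 0 ≤ r := by positivity
  have hd2 : d ≤ d ^ 2 := by nlinarith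
  have hd2N : 1 ≤ d ^ 2 * N := one_le_mul_of_one_le_of_one_le (hd1.trans hd2) hNR
  have hrN : N * r ≤ ν / 2 := by
    have h1 : N * r = ρ * ν / (2304 * d ^ 2) := by rw [hr]; field_simp
    rw [h1, div_le_iff₀ (by positivity)]
    nlinarith
  have hrρ : r ≤ ρ := by
    rw [hr, div_le_iff₀ (by positivity)]
    exact mul_le_mul_of_nonneg_left (by linarith) hρ0
  have hr6 : r ≤ 1 / 6 := by
    rw [hr, div_le_iff₀ (by positivity)]
    nlinarith
  obtain ⟨B', hB'c, hB'l, hB'u, hB'⟩ := exists_isRegular (B.chars ∪ Λ) hrpos hr6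
  refine ⟨B', hB', ⟨?_, hB'u.trans hrρ⟩, ?_, ?_, ?_⟩
  · rw [hB'c]; exact Finset.subset_union_left
  · rw [BohrSet.rank, hB'c]
    exact (Finset.card_union_le _ _).trans (Nat.add_le_add_left hΛ _)
  · refine le_trans (le_of_eq ?_) hB'l
    rw [hr]; field_simp; ring
  · intro t ht γ hγ
    rw [B'.points_eq, hB'c, mem_bohrPts] at ht
    obtain ⟨χ, hχ, hγχ⟩ := hspec γ hγ
    have hrank : B₁.rank = B.rank := by rw [BohrSet.rank, hB₁c]; rfl
    have hχt := norm_apply_sub_one_le_of_isRegular hB₁ (δ := ν / (96 * d)) (by positivity) (by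
        rw [hrank, mul_div_assoc', div_le_one (by positivity)]
        nlinarith) hχ (t := t) (by
        rw [mem_bohrPts, hB₁c]
        intro ψ hψ
        refine (ht ψ (Finset.mem_union_left _ hψ)).trans (hB'u.trans ?_)
        calc r = ν / (96 * d) * (ρ / (12 * d * N) / 2) := by rw [hr]; field_simp; ring
          _ ≤ _ := by gcongr)
    have h1 : 48 * (B₁.rank : ℝ) * (ν / (96 * d)) ≤ ν / 2 := by
      rw [hrank, mul_div_assoc', div_le_iff₀ (by positivity)]
      nlinarith
    have h2 : ∑ ψ ∈ Λ, ‖ψ t - 1‖ ≤ ν / 2 := by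
      calc ∑ ψ ∈ Λ, ‖ψ t - 1‖ ≤ ∑ _ψ ∈ Λ, r := Finset.sum_le_sum fun ψ hψ =>
            (ht ψ (Finset.mem_union_right _ hψ)).trans hB'u
        _ = Λ.card * r := by simp
        _ ≤ N * r := by gcongr
        _ ≤ _ := hrN
    linarith [hγχ t]

/-- The numerical choice of parameters. -/
theorem exists_parameters {ε η K σ : ℝ} (hε0 : 0 < ε) (hε1 : ε < 1) (hη0 : 0 < η) (hη1 : η ≤ 1)
    (hK : 1 ≤ K) (hσ0 : 0 < σ) (hσ1 : σ ≤ 1) :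
    ∃ k m n N : ℕ, 0 < k ∧ 0 < m ∧ m ≤ n ∧ 0 < N ∧ 2 / η ≤ Real.exp 1 ^ m ∧
      4 * Real.exp 1 ^ 2 * m ≤ (ε / (8 * k)) ^ 2 * n ∧ 2 * (1 / 4 : ℝ) ^ k ≤ ε * √η / 4 ∧
      8 * Real.log (4 / (σ / (2 * K ^ n))) < N ∧
      (N : ℝ) ≤ 1300000 * (ε⁻¹ ^ 2 * Real.log (2 / (ε * η)) ^ 2 * Real.log (2 / η) *
        Real.log (2 * K) + Real.log (1 / σ)) := by
  have hlog2 : 0.69 < Real.log 2 := lt_trans (by norm_num) Real.log_two_gt_d9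
  set l := Real.log (2 / (ε * η)) with hl
  set l₁ := Real.log (2 / η) with hl₁
  set lK := Real.log (2 * K) with hlK
  have hεη : ε * η ≤ 1 := mul_le_one₀ hε1.le hη0.le hη1
  have h2η : 2 ≤ 2 / η := by rw [le_div_iff₀ hη0]; linarith
  have h2εη : 2 ≤ 2 / (ε * η) := by rw [le_div_iff₀ (by positivity)]; linarith
  have hl69 : 0.69 ≤ l := hlog2.le.trans (Real.log_le_log (by norm_num) h2εη)
  have hl₁69 : 0.69 ≤ l₁ := hlog2.le.trans (Real.log_le_log (by norm_num) h2η)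
  have hlK69 : 0.69 ≤ lK := hlog2.le.trans (Real.log_le_log (by norm_num) (by linarith))
  obtain ⟨k, hkl, hku⟩ : ∃ k : ℕ, 3 * l ≤ k ∧ (k : ℝ) < 3 * l + 1 :=
    ⟨⌈3 * l⌉₊, Nat.le_ceil _, Nat.ceil_lt_add_one (by linarith)⟩
  obtain ⟨m, hml, hmu⟩ : ∃ m : ℕ, l₁ ≤ m ∧ (m : ℝ) < l₁ + 1 :=
    ⟨⌈l₁⌉₊, Nat.le_ceil _, Nat.ceil_lt_add_one (by linarith)⟩
  have hk0 : (0 : ℝ) < k := by linarith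
  have hk1 : (1 : ℝ) ≤ k := by
    have : 0 < k := by exact_mod_cast hk0
    exact_mod_cast this
  have hm0 : (0 : ℝ) < m := by linarith
  have he1 : 2.7 < Real.exp 1 := lt_trans (by norm_num) Real.exp_one_gt_d9
  have he2 : Real.exp 1 < 2.72 := lt_trans Real.exp_one_lt_d9 (by norm_num)
  -- Almost periods then have error `ε/(4k)` relative to `|A||M|`, and the two passages through `k`
  -- smoothing steps cost `ε/2` in total.
  set ε' := ε / (8 * k) with hε'
  have hε'0 : 0 < ε' := by positivity
  have hε'1 : ε' ≤ 1 := by rw [hε', div_le_one (by positivity)]; linarith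
  obtain ⟨n, hnl, hnu⟩ : ∃ n : ℕ, 4 * Real.exp 1 ^ 2 * m / ε' ^ 2 ≤ n ∧
      (n : ℝ) < 4 * Real.exp 1 ^ 2 * m / ε' ^ 2 + 1 :=
    ⟨⌈4 * Real.exp 1 ^ 2 * m / ε' ^ 2⌉₊, Nat.le_ceil _, Nat.ceil_lt_add_one (by positivity)⟩
  have hK0 : 0 < K := by linarith
  obtain ⟨N, hNl, hNu⟩ : ∃ N : ℕ, 8 * Real.log (4 / (σ / (2 * K ^ n))) < N ∧
      (N : ℝ) ≤ 8 * Real.log (4 / (σ / (2 * K ^ n))) + 1 := by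
    refine ⟨⌊8 * Real.log (4 / (σ / (2 * K ^ n)))⌋₊ + 1, ?_, ?_⟩
    · push_cast; exact Nat.lt_floor_add_one _
    · push_cast
      gcongr
      refine Nat.floor_le (mul_nonneg (by norm_num) (Real.log_nonneg ?_))
      rw [le_div_iff₀ (by positivity), one_mul, div_le_iff₀ (by positivity)]
      have := one_le_pow₀ hK (n := n)
      linarith
  have hlogτ : Real.log (4 / (σ / (2 * K ^ n))) = 3 * Real.log 2 + n * Real.log K + Real.log (1 / σ) := by
    have h1 : 4 / (σ / (2 * K ^ n)) = 2 ^ 3 * K ^ n * (1 / σ) := by field_simp; norm_num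
    rw [h1, Real.log_mul (by positivity) (by positivity), Real.log_mul (by positivity) (by positivity),
      Real.log_pow, Real.log_pow]
    norm_num
  have hlogK0 : 0 ≤ Real.log K := Real.log_nonneg hK
  have hlogσ0 : 0 ≤ Real.log (1 / σ) := Real.log_nonneg (by rw [le_div_iff₀ hσ0]; linarith)
  refine ⟨k, m, n, N, by exact_mod_cast hk0, by exact_mod_cast hm0, ?_, ?_, ?_, ?_, ?_, hNl, ?_⟩
  · have h1 : (m : ℝ) ≤ 4 * Real.exp 1 ^ 2 * m / ε' ^ 2 := by
      rw [le_div_iff₀ (by positivity)]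
      have h2 : ε' ^ 2 ≤ 1 := pow_le_one₀ hε'0.le hε'1
      calc m * ε' ^ 2 ≤ m * 1 := by gcongr
        _ ≤ 4 * Real.exp 1 ^ 2 * m := by
          have h3 := one_le_pow₀ (by linarith : 1 ≤ Real.exp 1) (n := 2)
          rw [mul_comm]
          gcongr
          linarith
    exact_mod_cast h1.trans hnl
  · have h1 : (0 : ℝ) < N := by
      refine lt_of_le_of_lt ?_ hNl
      rw [hlogτ]
      positivity
    exact_mod_cast h1
  · rw [← Real.exp_nat_mul, mul_one, ← Real.log_le_iff_le_exp (by positivity)]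
    exact hml
  · rw [div_le_iff₀ (by positivity)] at hnl
    linarith
  · have hsη : η ≤ √η := by
      rw [Real.le_sqrt' hη0]; exact pow_le_of_le_one hη0.le hη1 two_ne_zero
    have h4 : (2 / (ε * η)) ^ 3 ≤ (4 : ℝ) ^ k := by
      rw [← Real.log_le_log_iff (by positivity) (by positivity), Real.log_pow, Real.log_pow]
      have h5 : 1 ≤ Real.log 4 := by
        rw [show (4 : ℝ) = 2 ^ 2 by norm_num, Real.log_pow]; push_cast; linarith
      push_cast
      calc 3 * l ≤ k * 1 := by linarith
        _ ≤ k * Real.log 4 := by gcongr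
    have h6 : 8 / (ε * √η) ≤ (2 / (ε * η)) ^ 3 := by
      calc 8 / (ε * √η) ≤ 8 / (ε * η) := by gcongr
        _ ≤ 8 / (ε * η) ^ 3 := by
          have hpos : 0 < ε * η := by positivity
          gcongr
          exact pow_le_of_le_one hpos.le hεη (by norm_num)
        _ = _ := by rw [div_pow]; norm_num
    have h7 := h6.trans h4
    rw [div_le_iff₀ (by positivity)] at h7
    rw [one_div, inv_pow, ← div_eq_mul_inv, div_le_iff₀ (by positivity)]
    linarith
  · set Q := ε⁻¹ ^ 2 * l ^ 2 * l₁ with hQ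
    have hεinv : 1 ≤ ε⁻¹ ^ 2 := one_le_pow₀ ((one_le_inv₀ hε0).2 hε1.le)
    have hQ4 : 1 ≤ 4 * Q := by
      have h1 : (0.69:ℝ) ^ 2 ≤ l ^ 2 := by gcongr
      have h2 : 1 * 0.69 ^ 2 * 0.69 ≤ ε⁻¹ ^ 2 * l ^ 2 * l₁ := by gcongr
      rw [hQ]; norm_num at h2 ⊢; linarith
    have hkl5 : (k : ℝ) ≤ 5 * l := by linarith
    have hml3 : (m : ℝ) ≤ 3 * l₁ := by linarith
    have hn : (n : ℝ) ≤ 150000 * Q := by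
      have h1 : 4 * Real.exp 1 ^ 2 * m / ε' ^ 2 = 256 * Real.exp 1 ^ 2 * (ε⁻¹ ^ 2 * k ^ 2 * m) := by
        rw [hε']; field_simp; norm_num
      have h2 : ε⁻¹ ^ 2 * k ^ 2 * m ≤ ε⁻¹ ^ 2 * (5 * l) ^ 2 * (3 * l₁) := by gcongr
      have h3 : Real.exp 1 ^ 2 ≤ 7.4 := (pow_le_pow_left₀ (by positivity) he2.le 2).trans (by norm_num)
      have h4 : 256 * Real.exp 1 ^ 2 * (ε⁻¹ ^ 2 * k ^ 2 * m) ≤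
          256 * 7.4 * (ε⁻¹ ^ 2 * (5 * l) ^ 2 * (3 * l₁)) := by gcongr
      have h5 : ε⁻¹ ^ 2 * (5 * l) ^ 2 * (3 * l₁) = 75 * Q := by rw [hQ]; ring
      rw [h5] at h4
      rw [h1] at hnu
      linarith
    have hQ0 : 0 < Q := by linarith
    have hlogK : Real.log K ≤ lK := Real.log_le_log hK0 (by linarith)
    have hlog2K : Real.log 2 ≤ lK := Real.log_le_log (by norm_num) (by linarith)
    have h1 : n * Real.log K ≤ 150000 * Q * lK := by gcongr
    have h2 : lK ≤ 4 * Q * lK := le_mul_of_one_le_left (by linarith) hQ4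
    rw [hlogτ] at hNu
    linarith

end Assembly

/-! ### The main theorem. -/

/-- The norm of a function `G → ℂ` below is the supremum norm. The constant `C` is absolute. -/
theorem mainTheorem8 :
    ∃ C : ℝ, 0 < C ∧
      ∀ (G : Type*) [AddCommGroup G] [Fintype G] [DecidableEq G]
        (A M L S : Finset G) (B : BohrSet G) (ε K σ η : ℝ),
        0 < ε → ε < 1 →
        A.Nonempty → M.Nonempty → L.Nonempty →
        B.IsRegular → B.radius ≤ 2 →
        S ⊆ B.points → 0 < σ → σ ≤ (S.card : ℝ) / (B.points.card : ℝ) →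
        ((A + S).card : ℝ) ≤ K * (A.card : ℝ) →
        η = (M.card : ℝ) / (L.card : ℝ) → η ≤ 1 →
        ∃ (B' : BohrSet G) (d' : ℕ),
          B'.IsRegular ∧ B' ≤ B ∧
          0 < d' ∧
          (d' : ℝ) ≤ C * (ε⁻¹ ^ 2 * Real.log (2 / (ε * η)) ^ 2 * Real.log (2 / η)
              * Real.log (2 * K) + Real.log (1 / σ)) ∧
          B'.rank ≤ B.rank + d' ∧
          B.radius * ε * Real.sqrt η / ((max (B.rank : ℝ) 1) ^ 2 * (d' : ℝ)) ≤ B'.radius ∧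
          (∀ t ∈ B'.points,
            ‖(fun x => tripleConv A M L (x + t)) - tripleConv A M L‖
              ≤ ε * (A.card : ℝ) * (M.card : ℝ)) ∧
          ‖conv (tripleConv A M L) (setMu B'.points) - tripleConv A M L‖
            ≤ ε * (A.card : ℝ) * (M.card : ℝ) := by
  refine ⟨18432 * 1300000, by norm_num, ?_⟩
  intro G _ _ _ A M L S B ε K σ η hε0 hε1 hA hM hL hB hB2 hSB hσ0 hσ hK hη hη1
  have hApos : (0 : ℝ) < A.card := by exact_mod_cast hA.card_pos
  have hMpos : (0 : ℝ) < M.card := by exact_mod_cast hM.card_pos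
  have hLpos : (0 : ℝ) < L.card := by exact_mod_cast hL.card_pos
  have hBpos : (0 : ℝ) < B.points.card := by exact_mod_cast card_bohrPts_pos B.radius_nonneg
  have hη0 : 0 < η := by rw [hη]; positivity
  have hσS : σ * B.points.card ≤ S.card := (le_div_iff₀ hBpos).1 hσ
  have hSpos : (0 : ℝ) < S.card := lt_of_lt_of_le (by positivity) hσS
  have hS : S.Nonempty := Finset.card_pos.1 (by exact_mod_cast hSpos)
  have hσ1 : σ ≤ 1 := hσ.trans (div_le_one_of_le₀
    (by exact_mod_cast Finset.card_le_card hSB) hBpos.le)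
  have hK1 : 1 ≤ K := by
    have h1 : (A.card : ℝ) ≤ (A + S).card := by exact_mod_cast Finset.card_le_card_add_right hS
    have h2 := h1.trans hK
    by_contra! h
    nlinarith
  obtain ⟨k, m, n, N, hk, hm, hmn, hN, hme, hne, hkε, hNl, hNu⟩ :=
    exists_parameters hε0 hε1 hη0 hη1 hK1 hσ0 hσ1
  have hkR : (0 : ℝ) < k := by exact_mod_cast hk
  have hKn : 0 < K ^ n := by positivity
  obtain ⟨T, hTS, hTcard, hper⟩ := exists_almost_periods hA hM hL hK hm hmn (by
    have h1 : 2 / η = 2 * L.card / M.card := by rw [hη]; field_simp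
    rw [h1, div_le_iff₀ hMpos] at hme
    exact hme) (by positivity) hne
  have hTpos : (0 : ℝ) < T.card := by
    by_contra! h
    have : 2 * K ^ n * (T.card : ℝ) ≤ 0 := mul_nonpos_of_nonneg_of_nonpos (by positivity) h
    linarith
  have hT : T.Nonempty := Finset.card_pos.1 (by exact_mod_cast hTpos)
  have hTτ : σ / (2 * K ^ n) * B.points.card ≤ T.card := by
    rw [div_mul_eq_mul_div, div_le_iff₀ (by positivity)]
    linarith
  have hsη1 : √η ≤ 1 := Real.sqrt_le_one.2 hη1
  obtain ⟨B', hB', hB'B, hrank, hrad, hspec⟩ := exists_isRegular_of_large_spectrum hB hB2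
    (hTS.trans hSB) (by positivity) hTτ hN hNl (ν := ε * √η / 4) (by positivity) (by
      have : ε * √η ≤ 1 := mul_le_one₀ hε1.le (Real.sqrt_nonneg _) hsη1
      linarith)
  obtain ⟨c, hc, hcsum⟩ := exists_fourier_expansion A M L
  have hperC : ∀ t ∈ T, ∀ t' ∈ T, ∀ x, ‖∑ γ, c γ * γ (x + (t - t')) - ∑ γ, c γ * γ x‖ ≤
      2 * (ε / (8 * k)) * A.card * M.card := by
    intro t ht t' ht' x
    rw [← hc, ← hc, tripleConv_eq, tripleConv_eq, ← Complex.ofReal_sub, Complex.norm_real]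
    exact hper t ht t' ht' x
  -- The factor `√η` in the approximate-kernel condition exactly compensates the coefficient mass
  -- `|A| √(|M||L|)`.
  have hsqrt : √η * √(M.card * L.card) = M.card := by
    rw [← Real.sqrt_mul hη0.le, hη]
    rw [show (M.card / L.card * (M.card * L.card) : ℝ) = (M.card : ℝ) ^ 2 by field_simp]
    exact Real.sqrt_sq hMpos.le
  have hmain : ∀ t ∈ B'.points, ∀ x, ‖tripleConv A M L (x + t) - tripleConv A M L x‖ ≤
      ε * A.card * M.card := by
    intro t ht x
    rw [hc, hc]
    refine (norm_translate_sub_le c hT hperC k (by positivity) (hspec t ht) x).trans ?_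
    have h1 : (∑ γ, ‖c γ‖) * (ε * √η / 4 + 2 * (1 / 4) ^ k) ≤
        A.card * √(M.card * L.card) * (ε * √η / 4 + ε * √η / 4) := by gcongr
    have h2 : A.card * √(M.card * L.card) * (ε * √η / 4 + ε * √η / 4) =
        ε * A.card * M.card / 2 := by
      linear_combination ε * A.card / 2 * hsqrt
    have h3 : 2 * (k * (2 * (ε / (8 * k)) * A.card * M.card)) = ε * A.card * M.card / 2 := by
      field_simp; norm_num
    linarith
  -- `18432 = 4 * 4608`, from `ν = ε √η / 4` and the radius bound for `B'`. Putting this factor into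
  -- `d'` gives the radius bound without any constant.
  refine ⟨B', 18432 * N, hB', hB'B, by positivity, ?_, hrank.trans (by omega), ?_, ?_, ?_⟩
  · push_cast
    rw [mul_assoc]
    gcongr
  · refine le_trans (le_of_eq ?_) hrad
    push_cast
    field_simp; ring
  · intro t ht
    rw [pi_norm_le_iff_of_nonneg (by positivity)]
    exact hmain t ht
  · exact norm_conv_setMu_sub_le B'.radius_nonneg (by positivity) hmain
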